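/- Let $a\in C^2(\mathbb R)$ and let $M,\rho,\kappa$ be real numbers with $\rho>0$ such that $|a'(s)|\le M$, $|a''(s)|\le M$ and $\rho\le a(s)\le\kappa$ for all $s\in\mathbb R$. Let $T>0$, $Q_\tau=(0,1)\times(0,\tau)$ for $0\le\tau\le T$, $y_0\in H^1_0(0,1)$ and $f\in L^\infty(Q_T)$. Let $y\in L^\infty(Q_T)$ be such that (i) the weak derivative $y_x$ exists and $y,y_x\in L^2(Q_T)$; the map $t\mapsto y(\cdot,t)$ is continuous (in particular bounded) from $[0,T]$ to $L^2(0,1)$; and $y$ vanishes on the lateral boundary, that is, $y(\cdot,t)\in H^1_0(0,1)$ for almost every $t\in(0,T)$; (ii) $y$ is a weak solution of $$y_t-(a(y)y_x)_x=f\ \text{ in } Q_T,\qquad y(0,t)=y(1,t)=0,\qquad y(x,0)=y_0(x),$$ that is, for every $\tau\in[0,T]$ and every $\eta\in C^\infty(\overline{Q_T})$ vanishing near $\{0,1\}\times[0,T]$, $$\int_0^1 y(x,\tau)\eta(x,\tau)\,dx-\iint_{Q_\tau}y\,\eta_t\,dx\,dt+\iint_{Q_\tau}a(y)\,y_x\,\eta_x\,dx\,dt=\int_0^1y_0(x)\,\eta(x,0)\,dx+\iint_{Q_\tau}f\,\eta\,dx\,dt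 .$$ Then $$\sup_{Q_T}y\le\sup_{[0,1]}y_0+\frac6\rho\|f\|_{L^\infty(Q_T)},\qquad \inf_{Q_T}y\ge\inf_{[0,1]}y_0-\frac6\rho\|f\|_{L^\infty(Q_T)},$$ and hence $$\sup_{Q_T}|y|\le\sup_{[0,1]}|y_0|+\frac6\rho\|f\|_{L^\infty(Q_T)},$$ where suprema and infima are essential ones. -/

import Mathlib

namespace QuasilinearParabolic

open MeasureTheory Filter Topology Set
open scoped ContDiff NNReal

/-- The space-time cylinder `(0,1) × (0,T)`; points are written `(x, t)`. -/
def cyl (T : ℝ) : Set (ℝ × ℝ) := Ioo (0 : ℝ) 1 ×ˢ Ioo (0 : ℝ) T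

/-- Lebesgue measure on the interval `(0,1)`. -/
noncomputable def intervalMeasure : Measure ℝ := volume.restrict (Ioo (0 : ℝ) 1)

/-- Lebesgue measure on the cylinder `(0,1) × (0,T)`. -/
noncomputable def cylMeasure (T : ℝ) : Measure (ℝ × ℝ) := volume.restrict (cyl T)

/-- Classical partial derivative in `x`; it is only applied to smooth functions. -/
noncomputable def dx (φ : ℝ × ℝ → ℝ) (z : ℝ × ℝ) : ℝ := deriv (fun x => φ (x, z.2)) z.1

/-- Classical partial derivative in `t`; it is only applied to smooth functions. -/
noncomputable def dt (φ : ℝ × ℝ → ℝ) (z : ℝ × ℝ) : ℝ := deriv (fun t => φ (z.1, t)) z.2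

/-- `u ∈ H¹₀(0,1)`, the closure of `C_c^∞(0,1)` in `H¹(0,1)`: there are test functions converging
to `u` in `L²(0,1)` whose derivatives converge in `L²(0,1)`. -/
def MemH10 (u : ℝ → ℝ) : Prop :=
  MemLp u 2 intervalMeasure ∧
  ∃ g : ℝ → ℝ, MemLp g 2 intervalMeasure ∧
  ∃ φ : ℕ → ℝ → ℝ,
    (∀ n, ContDiff ℝ ∞ (φ n) ∧ HasCompactSupport (φ n) ∧ tsupport (φ n) ⊆ Ioo (0 : ℝ) 1) ∧
    Tendsto (fun n => eLpNorm (fun x => φ n x - u x) 2 intervalMeasure) atTop (𝓝 0) ∧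
    Tendsto (fun n => eLpNorm (fun x => deriv (φ n) x - g x) 2 intervalMeasure) atTop (𝓝 0)

/-- `p` is the weak derivative `y_x` of `y` on `(0,1) × (0,T)`. -/
def IsWeakDx (T : ℝ) (y p : ℝ × ℝ → ℝ) : Prop :=
  ∀ φ : ℝ × ℝ → ℝ, ContDiff ℝ ∞ φ → HasCompactSupport φ → tsupport φ ⊆ cyl T →
    ∫ z, y z * dx φ z ∂(cylMeasure T) = - ∫ z, p z * φ z ∂(cylMeasure T)

/-- `y ∈ W₂^{1,0}(Q_T)`: both `y` and its weak derivative `y_x` are square integrable. -/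
def MemW10 (T : ℝ) (y : ℝ × ℝ → ℝ) : Prop :=
  MemLp y 2 (cylMeasure T) ∧ ∃ p : ℝ × ℝ → ℝ, MemLp p 2 (cylMeasure T) ∧ IsWeakDx T y p

/-- `y ∈ V₂(Q_T) = L^∞(0,T; L²(0,1)) ∩ W₂^{1,0}(Q_T)`. -/
def MemV2 (T : ℝ) (y : ℝ × ℝ → ℝ) : Prop :=
  MemW10 T y ∧
  ∃ C : ℝ≥0, ∀ᵐ t ∂(volume.restrict (Ioo (0 : ℝ) T)),
    eLpNorm (fun x => y (x, t)) 2 intervalMeasure ≤ C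

/-- `y ∈ V̊₂^{1,0}(Q_T)`: `y ∈ V₂(Q_T)`, the map `t ↦ y(·,t)` is continuous from `[0,T]` to
`L²(0,1)`, and `y` vanishes on the lateral boundary. As `y(·,t)` has boundary values only at those
times at which it lies in `H¹(0,1)`, i.e. almost all times, the last condition reads
`y(·,t) ∈ H¹₀(0,1)` for almost every `t`. -/
structure MemV10 (T : ℝ) (y : ℝ × ℝ → ℝ) : Prop where
  memV2 : MemV2 T y
  memLp_slice : ∀ t ∈ Icc (0 : ℝ) T, MemLp (fun x => y (x, t)) 2 intervalMeasure
  continuous_slice : ∀ t ∈ Icc (0 : ℝ) T,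
    Tendsto (fun s => eLpNorm (fun x => y (x, s) - y (x, t)) 2 intervalMeasure)
      (𝓝[Icc (0 : ℝ) T] t) (𝓝 0)
  lateral : ∀ᵐ t ∂(volume.restrict (Ioo (0 : ℝ) T)), MemH10 (fun x => y (x, t))

/-- Smooth test functions on the closed cylinder that vanish near the lateral boundary
`{0,1} × [0,T]`; they need not vanish at `t = 0` or `t = T`. -/
def IsTest (T : ℝ) (η : ℝ × ℝ → ℝ) : Prop :=
  ContDiff ℝ ∞ η ∧ ∃ δ > (0 : ℝ), ∀ x ∈ Icc (0 : ℝ) 1, ∀ t ∈ Icc (0 : ℝ) T,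
    (x < δ ∨ 1 - δ < x) → η (x, t) = 0

/-- The weak form of `y_t - (a(y) y_x)_x = f` in `Q_T` with initial datum `y₀`: for all `τ ∈ [0,T]`
and all test functions `η`,
`∫ y(x,τ) η(x,τ) dx - ∬_{Q_τ} y η_t + ∬_{Q_τ} a(y) y_x η_x = ∫ y₀(x) η(x,0) dx + ∬_{Q_τ} f η`.
(The lateral boundary condition is part of `MemV10`.) -/
def IsWeakSolution (T : ℝ) (a : ℝ → ℝ) (f : ℝ × ℝ → ℝ) (y₀ : ℝ → ℝ) (y : ℝ × ℝ → ℝ) : Prop :=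
  ∃ p : ℝ × ℝ → ℝ, MemLp p 2 (cylMeasure T) ∧ IsWeakDx T y p ∧
    ∀ η : ℝ × ℝ → ℝ, IsTest T η → ∀ τ ∈ Icc (0 : ℝ) T,
      ∫ x, y (x, τ) * η (x, τ) ∂intervalMeasure
          - ∫ z, y z * dt η z ∂(cylMeasure τ)
          + ∫ z, a (y z) * p z * dx η z ∂(cylMeasure τ)
        = ∫ x, y₀ x * η (x, 0) ∂intervalMeasure
          + ∫ z, f z * η z ∂(cylMeasure τ)

end QuasilinearParabolic

/-! The bound is a comparison with a stationary supersolution. Let `A' = a` and let `F` be the norm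
of `f`. If `m ≥ 0` bounds `y₀` from above, define `w` by `A(w) = A(m) + F x(1-x)/2`, so that `-(a(w)
w_x)_x = F` and `w = m` at both ends. Then `y ≤ w`, and since `A' ≥ ρ` and `x(1-x) ≤ 1/4`, this
gives `y ≤ m + F/(8ρ)`, which is stronger than the constant `6/ρ`. The sign condition on `m` is
automatic, because `y₀` lies in `H¹₀`.

For the comparison let `θ` be a smooth nondecreasing step that vanishes exactly on `(-∞, 0]`.
Formally one tests with `θ(A(y) - A(w))`. Comparing `A(y)` with `A(w)`, not `y` with `w`, makes the
diffusion term `∫ θ' |(A(y) - A(w))_x|²`, which is nonnegative without any Lipschitz bound on `a`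
(`integral_cutoff_le`). The entropy `E(t)`, whose density in `y` is a primitive of the test
function, is then nonincreasing with `E(0) = 0`.

Since `y` has no time derivative in `L²`, the test function is frozen at a time `t`: `V(x) =
θ(A(y(x,t)) - A(w(x)))`. The difference of the weak forms at `t` and at `t - h`, with convexity of
the density, bounds `E(t) - E(t-h)` by the pairing of `q(r) - q(t)` with `V'`, integrated over `r`
in `(t-h, t)`, where `q = a(y) y_x` (`ofReal_energy_sub_le`). Integrated over `t` this is `o(h)`,
because time translations are continuous in `L²` (`exists_lintegral_increment_le`). A continuous
function starting at `0` whose positive increments are this small cannot become positive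
(`nonpos_of_lintegral_increment_le`).

`V` is only absolutely continuous, so the weak form has to be extended beyond smooth test functions;
the lemma of du Bois-Reymond does this (`weakForm_of_forall_bump`). The lower bound is the upper
bound for `-y`, which solves the equation with coefficient `a(-s)`. -/

namespace QuasilinearParabolic

open MeasureTheory Filter Topology Set
open scoped ContDiff NNReal ENNReal

/-! ### Test functions on the unit interval -/

/-- Smooth functions with compact support in `(0,1)`. -/
structure IsBump (φ : ℝ → ℝ) : Prop where
  contDiff : ContDiff ℝ ∞ φ
  hasCompactSupport : HasCompactSupport φ
  tsupport_subset : tsupport φ ⊆ Ioo (0 : ℝ) 1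

instance isProbabilityMeasure_intervalMeasure : IsProbabilityMeasure intervalMeasure :=
  ⟨by simp [intervalMeasure]⟩

theorem integral_intervalMeasure (g : ℝ → ℝ) :
    ∫ x, g x ∂intervalMeasure = ∫ x in (0 : ℝ)..1, g x := by
  rw [intervalMeasure, intervalIntegral.integral_of_le zero_le_one, integral_Ioc_eq_integral_Ioo]

theorem intervalIntegrable_iff_integrable_intervalMeasure {g : ℝ → ℝ} :
    IntervalIntegrable g volume 0 1 ↔ Integrable g intervalMeasure := by
  rw [intervalMeasure, intervalIntegrable_iff_integrableOn_Ioo_of_le zero_le_one]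
  rfl

theorem ae_intervalMeasure_mem : ∀ᵐ x ∂intervalMeasure, x ∈ Ioo (0 : ℝ) 1 :=
  ae_restrict_mem measurableSet_Ioo

theorem ae_intervalMeasure_of_ae {P : ℝ → Prop} (h : ∀ᵐ x, P x) : ∀ᵐ x ∂intervalMeasure, P x :=
  ae_restrict_of_ae h

theorem integrable_of_continuousOn {g : ℝ → ℝ} (hg : ContinuousOn g (Icc 0 1)) :
    Integrable g intervalMeasure :=
  (hg.integrableOn_Icc (μ := volume)).mono_set Ioo_subset_Icc_self

namespace IsBump

variable {φ ψ : ℝ → ℝ}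

theorem eq_zero (h : IsBump φ) {x : ℝ} (hx : x ∉ Ioo (0 : ℝ) 1) : φ x = 0 :=
  image_eq_zero_of_notMem_tsupport fun h' => hx (h.tsupport_subset h')

theorem sub (h : IsBump φ) (h' : IsBump ψ) : IsBump (fun x => φ x - ψ x) where
  contDiff := h.contDiff.sub h'.contDiff
  hasCompactSupport := h.hasCompactSupport.sub h'.hasCompactSupport
  tsupport_subset := (tsupport_sub φ ψ).trans (union_subset h.tsupport_subset h'.tsupport_subset)

theorem const_mul (h : IsBump φ) (c : ℝ) : IsBump (fun x => c * φ x) where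
  contDiff := contDiff_const.mul h.contDiff
  hasCompactSupport := h.hasCompactSupport.mul_left
  tsupport_subset := (tsupport_mul_subset_right).trans h.tsupport_subset

theorem integrable (h : IsBump φ) : Integrable φ intervalMeasure :=
  (h.contDiff.continuous.integrable_of_hasCompactSupport h.hasCompactSupport).mono_measure
    Measure.restrict_le_self

theorem memLp (h : IsBump φ) (p : ℝ≥0∞) : MemLp φ p intervalMeasure :=
  (h.contDiff.continuous.memLp_of_hasCompactSupport h.hasCompactSupport).mono_measure
    Measure.restrict_le_self

theorem continuous_deriv (h : IsBump φ) : Continuous (deriv φ) :=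
  h.contDiff.continuous_deriv (by simp)

theorem memLp_deriv (h : IsBump φ) (p : ℝ≥0∞) : MemLp (deriv φ) p intervalMeasure :=
  (h.continuous_deriv.memLp_of_hasCompactSupport h.hasCompactSupport.deriv).mono_measure
    Measure.restrict_le_self

theorem exists_margin (h : IsBump φ) :
    ∃ δ > (0 : ℝ), δ < 1 / 2 ∧ ∀ x, (x < δ ∨ 1 - δ < x) → φ x = 0 := by
  have hK : IsCompact (tsupport φ) := h.hasCompactSupport
  rcases (tsupport φ).eq_empty_or_nonempty with h0 | hne
  · refine ⟨1 / 4, by norm_num, by norm_num, fun x _ => image_eq_zero_of_notMem_tsupport ?_⟩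
    simp [h0]
  · have h1 := h.tsupport_subset (hK.sInf_mem hne)
    have h2 := h.tsupport_subset (hK.sSup_mem hne)
    refine ⟨min (1 / 4) (min (sInf (tsupport φ)) (1 - sSup (tsupport φ))), ?_, ?_, ?_⟩
    · have := h1.1; have := h2.2
      simp only [gt_iff_lt, lt_min_iff]
      exact ⟨by norm_num, h1.1, by linarith⟩
    · exact (min_le_left _ _).trans_lt (by norm_num)
    · intro x hx
      refine image_eq_zero_of_notMem_tsupport fun hmem => ?_
      have h3 := csInf_le hK.bddBelow hmem
      have h4 := le_csSup hK.bddAbove hmem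
      rcases hx with hx | hx
      · have := hx.trans_le ((min_le_right _ _).trans (min_le_left _ _)); linarith
      · have := (min_le_right (1 / 4 : ℝ) _).trans (min_le_right (sInf (tsupport φ)) (1 - sSup (tsupport φ)))
        linarith

/-- The primitive from `0` vanishes to the left of the support, and to the right of it equals the
total integral, which is zero. -/
theorem exists_deriv_eq (h : IsBump ψ) (h0 : ∫ x, ψ x ∂intervalMeasure = 0) :
    ∃ φ, IsBump φ ∧ deriv φ = ψ := by
  obtain ⟨δ, hδ, hδ2, hz⟩ := h.exists_margin
  have hc := h.contDiff.continuous
  have hd : ∀ x, HasDerivAt (fun x => ∫ t in (0 : ℝ)..x, ψ t) (ψ x) x := fun x =>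
    hc.integral_hasStrictDerivAt 0 x |>.hasDerivAt
  have hsupp : Function.support (fun x => ∫ t in (0 : ℝ)..x, ψ t) ⊆ Icc δ (1 - δ) := by
    intro x hx
    by_contra hx'
    apply hx
    rw [mem_Icc, not_and_or, not_le, not_le] at hx'
    rcases hx' with hx' | hx'
    · refine intervalIntegral.integral_zero_ae (ae_of_all _ fun t ht => hz t (Or.inl ?_))
      rcases mem_uIoc.1 ht with h | h <;> linarith [h.1, h.2]
    · have h1 : ∫ t in (1 : ℝ)..x, ψ t = 0 := by
        refine intervalIntegral.integral_zero_ae (ae_of_all _ fun t ht => hz t (Or.inr ?_))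
        rcases mem_uIoc.1 ht with h | h <;> linarith [h.1, h.2]
      show ∫ t in (0 : ℝ)..x, ψ t = 0
      rw [← intervalIntegral.integral_add_adjacent_intervals (hc.intervalIntegrable 0 1)
        (hc.intervalIntegrable 1 x), h1, ← integral_intervalMeasure, h0, add_zero]
  have hts : tsupport (fun x => ∫ t in (0 : ℝ)..x, ψ t) ⊆ Icc δ (1 - δ) :=
    closure_minimal hsupp isClosed_Icc
  have hder : deriv (fun x => ∫ t in (0 : ℝ)..x, ψ t) = ψ := funext fun x => (hd x).deriv
  refine ⟨fun x => ∫ t in (0 : ℝ)..x, ψ t, ⟨?_, ?_, ?_⟩, hder⟩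
  · rw [contDiff_infty_iff_deriv, hder]
    exact ⟨fun x => (hd x).differentiableAt, h.contDiff⟩
  · exact HasCompactSupport.intro' isCompact_Icc isClosed_Icc fun x hx => by
      by_contra h'
      exact hx (hsupp h')
  · exact hts.trans fun x hx => ⟨hδ.trans_le hx.1, by linarith [hx.2]⟩

theorem exists_integral_eq_one : ∃ b, IsBump b ∧ ∫ x, b x ∂intervalMeasure = 1 := by
  obtain ⟨f, hts, hcs, hcd, hr, h1⟩ := exists_contDiff_tsupport_subset (n := ⊤)
    (Ioo_mem_nhds (show (0 : ℝ) < 1 / 2 by norm_num) (show (1 / 2 : ℝ) < 1 by norm_num))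
  have hf : IsBump f := ⟨by exact_mod_cast hcd, hcs, hts⟩
  have hpos : 0 < ∫ x, f x ∂intervalMeasure := by
    have h2 : 0 < ∫ x, f x := by
      refine hcd.continuous.integral_pos_of_hasCompactSupport_nonneg_nonzero hcs
        (fun x => (hr ⟨x, rfl⟩).1) (x := 1 / 2) (by rw [h1]; norm_num)
    rwa [intervalMeasure, setIntegral_eq_integral_of_forall_compl_eq_zero fun x hx => hf.eq_zero hx]
  refine ⟨fun x => (∫ x, f x ∂intervalMeasure)⁻¹ * f x, hf.const_mul _, ?_⟩
  rw [integral_const_mul, inv_mul_cancel₀ hpos.ne']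

theorem absolutelyContinuousOnInterval (h : IsBump φ) : AbsolutelyContinuousOnInterval φ 0 1 :=
  (h.contDiff.of_le (by simp)).contDiffOn.absolutelyContinuousOnInterval

end IsBump

/-! ### Integration by parts and the lemma of du Bois-Reymond -/

theorem ae_eq_zero_of_forall_integral_bump {g : ℝ → ℝ} (hg : Integrable g intervalMeasure)
    (h : ∀ ψ, IsBump ψ → ∫ x, ψ x * g x ∂intervalMeasure = 0) : ∀ᵐ x ∂intervalMeasure, g x = 0 := by
  rw [intervalMeasure, ae_restrict_iff' measurableSet_Ioo]
  refine isOpen_Ioo.ae_eq_zero_of_integral_contDiff_smul_eq_zero (μ := volume)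
    (IntegrableOn.locallyIntegrableOn hg) fun ψ h1 h2 h3 => ?_
  have hψ : IsBump ψ := ⟨h1, h2, h3⟩
  rw [← h ψ hψ, intervalMeasure, setIntegral_eq_integral_of_forall_compl_eq_zero]
  · rfl
  · intro x hx
    rw [hψ.eq_zero hx, zero_mul]

theorem absolutelyContinuousOnInterval_primitive {d : ℝ → ℝ} (hd : Integrable d intervalMeasure) :
    AbsolutelyContinuousOnInterval (fun x => ∫ t in (0 : ℝ)..x, d t) 0 1 :=
  (intervalIntegrable_iff_integrable_intervalMeasure.2 hd).absolutelyContinuousOnInterval_intervalIntegral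
    (by simp)

theorem ae_hasDerivAt_primitive {d : ℝ → ℝ} (hd : Integrable d intervalMeasure) :
    ∀ᵐ x ∂intervalMeasure, HasDerivAt (fun x => ∫ t in (0 : ℝ)..x, d t) (d x) x := by
  filter_upwards [ae_intervalMeasure_of_ae
    (intervalIntegrable_iff_integrable_intervalMeasure.2 hd).ae_hasDerivAt_integral,
    ae_intervalMeasure_mem] with x hx hx'
  exact hx (by rw [uIcc_of_le zero_le_one]; exact Ioo_subset_Icc_self hx') 0 (by simp)

theorem integrable_mul_of_continuousOn {d g : ℝ → ℝ} (hd : Integrable d intervalMeasure)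
    (hg : ContinuousOn g (Icc 0 1)) : Integrable (fun x => d x * g x) intervalMeasure := by
  rw [← intervalIntegrable_iff_integrable_intervalMeasure] at hd ⊢
  exact hd.mul_continuousOn (by rwa [uIcc_of_le zero_le_one])

theorem continuousOn_Icc_of_absolutelyContinuous {V : ℝ → ℝ}
    (hV : AbsolutelyContinuousOnInterval V 0 1) : ContinuousOn V (Icc 0 1) := by
  simpa [uIcc_of_le zero_le_one] using hV.continuousOn

theorem ae_eq_deriv {V w : ℝ → ℝ} (h : ∀ᵐ x ∂intervalMeasure, HasDerivAt V (w x) x) :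
    deriv V =ᵐ[intervalMeasure] w := by
  filter_upwards [h] with x hx using hx.deriv

theorem integral_mul_deriv_of_absolutelyContinuous {G V d w : ℝ → ℝ}
    (hG : AbsolutelyContinuousOnInterval G 0 1) (hV : AbsolutelyContinuousOnInterval V 0 1)
    (hd : ∀ᵐ x ∂intervalMeasure, HasDerivAt G (d x) x)
    (hw : ∀ᵐ x ∂intervalMeasure, HasDerivAt V (w x) x) :
    ∫ x, G x * w x ∂intervalMeasure
      = G 1 * V 1 - G 0 * V 0 - ∫ x, d x * V x ∂intervalMeasure := by
  have h := hG.integral_mul_deriv_eq_deriv_mul hV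
  rw [← integral_intervalMeasure, ← integral_intervalMeasure] at h
  rw [integral_congr_ae (g := fun x => G x * deriv V x), h,
    integral_congr_ae (f := fun x => d x * V x) (g := fun x => deriv G x * V x)]
  · filter_upwards [ae_eq_deriv hd] with x hx
    simp only [hx]
  · filter_upwards [ae_eq_deriv hw] with x hx
    simp only [hx]

/-- The lemma of du Bois-Reymond on `(0,1)`. -/
theorem exists_ae_eq_primitive {Q d : ℝ → ℝ} (hQ : Integrable Q intervalMeasure)
    (hd : Integrable d intervalMeasure)
    (h : ∀ φ, IsBump φ → ∫ x, Q x * deriv φ x ∂intervalMeasure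
      = -∫ x, d x * φ x ∂intervalMeasure) :
    ∃ c : ℝ, ∀ᵐ x ∂intervalMeasure, Q x = c + ∫ t in (0 : ℝ)..x, d t := by
  obtain ⟨b, hb, hb1⟩ := IsBump.exists_integral_eq_one
  set G : ℝ → ℝ := fun x => ∫ t in (0 : ℝ)..x, d t with hG
  have hGac := absolutelyContinuousOnInterval_primitive hd
  have hGi : Integrable G intervalMeasure := integrable_of_continuousOn
    (continuousOn_Icc_of_absolutelyContinuous hGac)
  have hQG : Integrable (fun x => Q x - G x) intervalMeasure := hQ.sub hGi
  -- `Q - G` has zero weak derivative; it remains to see that it is constant.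
  have key : ∀ φ, IsBump φ → ∫ x, (Q x - G x) * deriv φ x ∂intervalMeasure = 0 := by
    intro φ hφ
    have h1 := integral_mul_deriv_of_absolutelyContinuous hGac hφ.absolutelyContinuousOnInterval
      (ae_hasDerivAt_primitive hd) (ae_of_all _ fun x =>
        (hφ.contDiff.differentiable (by simp) x).hasDerivAt)
    rw [hφ.eq_zero (x := 1) (by simp), hφ.eq_zero (x := 0) (by simp)] at h1
    simp only [sub_mul]
    rw [integral_sub (integrable_mul_of_continuousOn hQ hφ.continuous_deriv.continuousOn)
      (integrable_mul_of_continuousOn hGi hφ.continuous_deriv.continuousOn), h φ hφ, h1]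
    simp
  set c := ∫ x, (Q x - G x) * b x ∂intervalMeasure with hc
  refine ⟨c, ?_⟩
  have hz : ∀ᵐ x ∂intervalMeasure, Q x - G x - c = 0 := by
    refine ae_eq_zero_of_forall_integral_bump (hQG.sub (integrable_const c)) fun ψ hψ => ?_
    set J := ∫ x, ψ x ∂intervalMeasure with hJ
    -- Subtracting `J * b` removes the mean of `ψ`, so the rest is the derivative of a bump and
    -- `key` applies. The `b` component produces the constant `c`.
    obtain ⟨φ, hφ, hφ'⟩ := (hψ.sub (hb.const_mul J)).exists_deriv_eq (by
      rw [integral_sub hψ.integrable (hb.integrable.const_mul J), integral_const_mul, hb1, ← hJ]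
      simp)
    have h2 := key φ hφ
    rw [hφ'] at h2
    have h3 : ∀ x, ψ x * (Q x - G x - c)
        = (Q x - G x) * (ψ x - J * b x) + (J * ((Q x - G x) * b x) - c * ψ x) := fun x => by ring
    have i1 : Integrable (fun x => (Q x - G x) * (ψ x - J * b x)) intervalMeasure :=
      integrable_mul_of_continuousOn hQG (hψ.sub (hb.const_mul J)).contDiff.continuous.continuousOn
    have i2 : Integrable (fun x => J * ((Q x - G x) * b x)) intervalMeasure :=
      (integrable_mul_of_continuousOn hQG hb.contDiff.continuous.continuousOn).const_mul J
    have i3 : Integrable (fun x => c * ψ x) intervalMeasure := hψ.integrable.const_mul c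
    have i4 : Integrable (fun x => J * ((Q x - G x) * b x) - c * ψ x) intervalMeasure := i2.sub i3
    simp only [h3]
    beta_reduce at h2
    rw [integral_add i1 i4, integral_sub i2 i3, h2, integral_const_mul,
      integral_const_mul, ← hc, ← hJ]
    ring
  filter_upwards [hz] with x hx
  linarith

/-- `Q` agrees almost everywhere with an absolutely continuous function, for which integration by
parts against `V` is classical. -/
theorem integral_mul_deriv_of_forall_bump {Q d V w : ℝ → ℝ} (hQ : Integrable Q intervalMeasure)
    (hd : Integrable d intervalMeasure)
    (h : ∀ φ, IsBump φ → ∫ x, Q x * deriv φ x ∂intervalMeasure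
      = -∫ x, d x * φ x ∂intervalMeasure)
    (hV : AbsolutelyContinuousOnInterval V 0 1) (h0 : V 0 = 0) (h1 : V 1 = 0)
    (hw : ∀ᵐ x ∂intervalMeasure, HasDerivAt V (w x) x) :
    ∫ x, Q x * w x ∂intervalMeasure = -∫ x, d x * V x ∂intervalMeasure := by
  obtain ⟨c, hc⟩ := exists_ae_eq_primitive hQ hd h
  have hac := absolutelyContinuousOnInterval_primitive hd
  have hac' : AbsolutelyContinuousOnInterval (fun x => c + ∫ t in (0 : ℝ)..x, d t) 0 1 := by
    have hcc : AbsolutelyContinuousOnInterval (fun _ : ℝ => c) 0 1 :=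
      contDiff_const.contDiffOn.absolutelyContinuousOnInterval
    exact hcc.add hac
  have := integral_mul_deriv_of_absolutelyContinuous hac' hV
    (by filter_upwards [ae_hasDerivAt_primitive hd] with x hx using hx.const_add c) hw
  rw [h0, h1] at this
  rw [integral_congr_ae (g := fun x => (c + ∫ t in (0 : ℝ)..x, d t) * w x), this]
  · ring
  · filter_upwards [hc] with x hx
    simp only [hx]

/-! ### Limits of `L²` pairings and derivatives in `H¹₀(0,1)` -/

theorem enorm_integral_mul_le {α : Type*} [MeasurableSpace α] {ν : Measure α} {g k : α → ℝ}
    (hg : AEStronglyMeasurable g ν) (hk : AEStronglyMeasurable k ν) :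
    ‖∫ x, g x * k x ∂ν‖ₑ ≤ eLpNorm g 2 ν * eLpNorm k 2 ν := by
  calc ‖∫ x, g x * k x ∂ν‖ₑ ≤ ∫⁻ x, ‖g x * k x‖ₑ ∂ν := enorm_integral_le_lintegral_enorm _
    _ = eLpNorm (g • k) 1 ν := by rw [eLpNorm_one_eq_lintegral_enorm]; rfl
    _ ≤ eLpNorm g 2 ν * eLpNorm k 2 ν := eLpNorm_smul_le_mul_eLpNorm hk hg

theorem tendsto_integral_mul_of_tendsto_eLpNorm {α : Type*} [MeasurableSpace α] {ν : Measure α}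
    {g k : α → ℝ} {gn : ℕ → α → ℝ} (hg : MemLp g 2 ν) (hgn : ∀ n, MemLp (gn n) 2 ν)
    (hk : MemLp k 2 ν) (h : Tendsto (fun n => eLpNorm (fun x => gn n x - g x) 2 ν) atTop (𝓝 0)) :
    Tendsto (fun n => ∫ x, gn n x * k x ∂ν) atTop (𝓝 (∫ x, g x * k x ∂ν)) := by
  rw [tendsto_iff_edist_tendsto_0]
  have hlim : Tendsto (fun n => eLpNorm (fun x => gn n x - g x) 2 ν * eLpNorm k 2 ν) atTop (𝓝 0) := by
    simpa using ENNReal.Tendsto.mul_const h (Or.inr hk.eLpNorm_ne_top)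
  refine tendsto_of_tendsto_of_tendsto_of_le_of_le tendsto_const_nhds hlim (fun _ => zero_le)
    fun n => ?_
  have : ∫ x, gn n x * k x ∂ν - ∫ x, g x * k x ∂ν = ∫ x, (gn n x - g x) * k x ∂ν := by
    have i1 : Integrable (fun x => gn n x * k x) ν := (hgn n).integrable_mul hk
    have i2 : Integrable (fun x => g x * k x) ν := hg.integrable_mul hk
    rw [← integral_sub i1 i2]
    simp only [sub_mul]
  show edist (∫ x, gn n x * k x ∂ν) (∫ x, g x * k x ∂ν) ≤ _
  rw [edist_eq_enorm_sub, this]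
  exact enorm_integral_mul_le ((hgn n).sub hg).aestronglyMeasurable hk.aestronglyMeasurable

theorem memLp_of_continuousOn {k : ℝ → ℝ} (hk : ContinuousOn k (Icc 0 1)) (p : ℝ≥0∞) :
    MemLp k p intervalMeasure := by
  obtain ⟨C, hC⟩ := isCompact_Icc.exists_bound_of_continuousOn hk
  refine MemLp.of_bound (integrable_of_continuousOn hk).aestronglyMeasurable C ?_
  filter_upwards [ae_intervalMeasure_mem] with x hx using hC x (Ioo_subset_Icc_self hx)

/-- `g` is the derivative of `u` in the sense of `H¹₀(0,1)`: integration by parts holds without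
boundary terms against functions that need not vanish at the end points. -/
def IsH10Deriv (u g : ℝ → ℝ) : Prop :=
  ∀ ψ : ℝ → ℝ, ContDiff ℝ 1 ψ →
    ∫ x, u x * deriv ψ x ∂intervalMeasure = -∫ x, g x * ψ x ∂intervalMeasure

/-- The approximating bumps vanish at both ends, so their integration by parts has no boundary
terms, and the identity passes to the `L²` limit. -/
theorem MemH10.exists_isH10Deriv {u : ℝ → ℝ} (hu : MemH10 u) :
    ∃ g, MemLp g 2 intervalMeasure ∧ IsH10Deriv u g := by
  obtain ⟨hu2, g, hg, φ, hφ, h1, h2⟩ := hu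
  have hb : ∀ n, IsBump (φ n) := fun n => ⟨(hφ n).1, (hφ n).2.1, (hφ n).2.2⟩
  refine ⟨g, hg, fun ψ hψ => ?_⟩
  have e : ∀ n, ∫ x, φ n x * deriv ψ x ∂intervalMeasure
      = -∫ x, deriv (φ n) x * ψ x ∂intervalMeasure := fun n => by
    have := integral_mul_deriv_of_absolutelyContinuous (hb n).absolutelyContinuousOnInterval
      hψ.contDiffOn.absolutelyContinuousOnInterval
      (ae_of_all _ fun x => ((hb n).contDiff.differentiable (by simp) x).hasDerivAt)
      (ae_of_all _ fun x => (hψ.differentiable one_ne_zero x).hasDerivAt)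
    rw [this, (hb n).eq_zero (x := 1) (by simp), (hb n).eq_zero (x := 0) (by simp)]
    ring
  refine tendsto_nhds_unique (tendsto_integral_mul_of_tendsto_eLpNorm hu2
    (fun n => (hb n).memLp 2) (memLp_of_continuousOn (hψ.continuous_deriv le_rfl).continuousOn 2) h1) ?_
  simp only [e]
  exact (tendsto_integral_mul_of_tendsto_eLpNorm hg (fun n => (hb n).memLp_deriv 2)
    (memLp_of_continuousOn hψ.continuous.continuousOn 2) h2).neg

/-- Encodes the boundary condition at `1`: the primitive of `g` from `0` returns to zero there. -/
theorem IsH10Deriv.integral_eq_zero {u g : ℝ → ℝ} (h : IsH10Deriv u g) :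
    ∫ x, g x ∂intervalMeasure = 0 := by
  simpa using h (fun _ => 1) contDiff_const

/-- Bumps determine `u` up to a constant; testing with the identity function, which does not vanish
at `1`, shows that the constant is zero. -/
theorem IsH10Deriv.ae_eq {u g : ℝ → ℝ} (h : IsH10Deriv u g) (hu : Integrable u intervalMeasure)
    (hg : Integrable g intervalMeasure) :
    ∀ᵐ x ∂intervalMeasure, u x = ∫ t in (0 : ℝ)..x, g t := by
  obtain ⟨c, hc⟩ := exists_ae_eq_primitive hu hg fun φ hφ => h φ (hφ.contDiff.of_le (by simp))
  have hac := absolutelyContinuousOnInterval_primitive hg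
  have hi : Integrable (fun x => ∫ t in (0 : ℝ)..x, g t) intervalMeasure :=
    integrable_of_continuousOn (continuousOn_Icc_of_absolutelyContinuous hac)
  have h1 := integral_mul_deriv_of_absolutelyContinuous hac
    (contDiff_id (𝕜 := ℝ) (n := 1)).contDiffOn.absolutelyContinuousOnInterval
    (ae_hasDerivAt_primitive hg) (ae_of_all _ hasDerivAt_id)
  have h2 := h id contDiff_id
  have h3 := h.integral_eq_zero
  rw [integral_intervalMeasure] at h3
  simp only [h3, deriv_id, mul_one, intervalIntegral.integral_same, id, zero_sub, zero_mul,
    sub_zero] at h1 h2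
  rw [integral_congr_ae hc, integral_add (integrable_const c) hi, h1] at h2
  have hc0 : c = 0 := by simpa using h2
  filter_upwards [hc] with x hx
  rw [hx, hc0, zero_add]

/-- Separability of `L²` provides a countable dense set of bumps. Countability is needed because the
null set of exceptional times depends on the test function. -/
theorem exists_countable_separating_bumps :
    ∃ S : Set (ℝ → ℝ), S.Countable ∧ (∀ φ ∈ S, IsBump φ) ∧
      ∀ g, MemLp g 2 intervalMeasure → (∀ φ ∈ S, ∫ x, φ x * g x ∂intervalMeasure = 0) →
        ∀ᵐ x ∂intervalMeasure, g x = 0 := by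
  let B : Set (Lp ℝ 2 intervalMeasure) := {F | ∃ φ, IsBump φ ∧ F =ᵐ[intervalMeasure] φ}
  have : Fact ((2 : ℝ≥0∞) ≠ ⊤) := ⟨by simp⟩
  obtain ⟨t, htB, htc, ht⟩ :=
    (TopologicalSpace.IsSeparable.of_separableSpace B).exists_countable_dense_subset
  choose! r hr hr' using htB
  refine ⟨r '' t, htc.image r, ?_, fun g hg h => ?_⟩
  · rintro _ ⟨F, hF, rfl⟩
    exact hr hF
  · have hclosed : IsClosed {F : Lp ℝ 2 intervalMeasure | inner ℝ F (hg.toLp g) = 0} :=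
      isClosed_eq (by fun_prop) continuous_const
    have inner_eq : ∀ (F : Lp ℝ 2 intervalMeasure) (φ : ℝ → ℝ), F =ᵐ[intervalMeasure] φ →
        inner ℝ F (hg.toLp g) = ∫ x, φ x * g x ∂intervalMeasure := fun F φ hF => by
      rw [L2.inner_def]
      refine integral_congr_ae ?_
      filter_upwards [hF, hg.coeFn_toLp] with x h1 h2
      simp [h1, h2, mul_comm]
    have hsub : closure t ⊆ {F : Lp ℝ 2 intervalMeasure | inner ℝ F (hg.toLp g) = 0} :=
      closure_minimal (fun F hF => by
        rw [mem_ofPred_eq, inner_eq F _ (hr' hF)]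
        exact h _ ⟨F, hF, rfl⟩) hclosed
    refine ae_eq_zero_of_forall_integral_bump (hg.integrable (by simp)) fun ψ hψ => ?_
    rw [← inner_eq _ _ (hψ.memLp 2).coeFn_toLp]
    exact hsub (ht ⟨ψ, hψ, (hψ.memLp 2).coeFn_toLp⟩)

/-! ### Time slices of functions on the cylinder -/

/-- Lebesgue measure on the time interval `(0,T)`. -/
noncomputable def timeMeasure (T : ℝ) : Measure ℝ := volume.restrict (Ioo (0 : ℝ) T)

instance isFiniteMeasure_timeMeasure (T : ℝ) : IsFiniteMeasure (timeMeasure T) :=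
  ⟨by simp [timeMeasure]⟩

theorem cylMeasure_eq_prod (T : ℝ) : cylMeasure T = intervalMeasure.prod (timeMeasure T) := by
  rw [cylMeasure, cyl, intervalMeasure, timeMeasure, Measure.prod_restrict]
  rfl

instance isFiniteMeasure_cylMeasure (T : ℝ) : IsFiniteMeasure (cylMeasure T) := by
  rw [cylMeasure_eq_prod]
  infer_instance

theorem ae_ae_of_ae_cylMeasure {T : ℝ} {P : ℝ × ℝ → Prop} (h : ∀ᵐ z ∂(cylMeasure T), P z) :
    ∀ᵐ t ∂(timeMeasure T), ∀ᵐ x ∂intervalMeasure, P (x, t) := by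
  rw [cylMeasure_eq_prod] at h
  exact Measure.ae_ae_of_ae_prod (Measure.measurePreserving_swap.quasiMeasurePreserving.ae h)

theorem ae_memLp_slice {T : ℝ} {p : ℝ × ℝ → ℝ} (hp : MemLp p 2 (cylMeasure T)) :
    ∀ᵐ t ∂(timeMeasure T), MemLp (fun x => p (x, t)) 2 intervalMeasure := by
  have h1 := hp.integrable_sq
  have h2 := hp.aestronglyMeasurable
  rw [cylMeasure_eq_prod] at h1 h2
  filter_upwards [h1.prod_left_ae, h2.prodMk_right] with t h3 h4
  exact (memLp_two_iff_integrable_sq h4).2 h3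

theorem dx_mul (φ ψ : ℝ → ℝ) (z : ℝ × ℝ) :
    dx (fun z => φ z.1 * ψ z.2) z = deriv φ z.1 * ψ z.2 := by
  simp only [dx]
  exact deriv_mul_const_field _

/-- Products `φ(x) ψ(t)` are admissible in the weak derivative; as `ψ` is arbitrary, the fundamental
lemma in `t` localizes the identity to almost every time. -/
theorem ae_forall_bump_of_isWeakDx {T : ℝ} {y p : ℝ × ℝ → ℝ} (hy : MemLp y 2 (cylMeasure T))
    (hp : MemLp p 2 (cylMeasure T)) (h : IsWeakDx T y p) {φ : ℝ → ℝ} (hφ : IsBump φ) :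
    ∀ᵐ t ∂(timeMeasure T), ∫ x, y (x, t) * deriv φ x ∂intervalMeasure
      = -∫ x, p (x, t) * φ x ∂intervalMeasure := by
  have hb1 : MemLp (fun z : ℝ × ℝ => deriv φ z.1) 2 (cylMeasure T) := by
    rw [cylMeasure_eq_prod]
    exact (hφ.memLp_deriv 2).comp_fst (timeMeasure T)
  have hb2 : MemLp (fun z : ℝ × ℝ => φ z.1) 2 (cylMeasure T) := by
    rw [cylMeasure_eq_prod]
    exact (hφ.memLp 2).comp_fst (timeMeasure T)
  have i1 : Integrable (fun z : ℝ × ℝ => y z * deriv φ z.1 + p z * φ z.1)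
      (intervalMeasure.prod (timeMeasure T)) := by
    rw [← cylMeasure_eq_prod]
    exact (hy.integrable_mul hb1).add (hp.integrable_mul hb2)
  have key : ∀ᵐ t, t ∈ Ioo 0 T →
      ∫ x, (y (x, t) * deriv φ x + p (x, t) * φ x) ∂intervalMeasure = 0 := by
    refine isOpen_Ioo.ae_eq_zero_of_integral_contDiff_smul_eq_zero (μ := volume)
      (IntegrableOn.locallyIntegrableOn i1.integral_prod_right) fun ψ h1 h2 h3 => ?_
    have htest := h (fun z => φ z.1 * ψ z.2)
      ((hφ.contDiff.comp contDiff_fst).mul (h1.comp contDiff_snd))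
      (by
        refine HasCompactSupport.intro (hφ.hasCompactSupport.isCompact.prod h2.isCompact)
          fun z hz => ?_
        rw [mem_prod, not_and_or] at hz
        rcases hz with hz | hz
        · rw [image_eq_zero_of_notMem_tsupport hz, zero_mul]
        · rw [image_eq_zero_of_notMem_tsupport hz, mul_zero])
      (by
        refine (closure_minimal ?_ ((isClosed_tsupport φ).prod (isClosed_tsupport ψ))).trans
          (prod_mono hφ.tsupport_subset h3)
        intro z hz
        have hz' : φ z.1 * ψ z.2 ≠ 0 := hz
        exact ⟨subset_tsupport _ (left_ne_zero_of_mul hz'),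
          subset_tsupport _ (right_ne_zero_of_mul hz')⟩)
    simp only [dx_mul] at htest
    obtain ⟨C, hC⟩ := h2.exists_bound_of_continuous h1.continuous
    have hψm : AEStronglyMeasurable (fun z : ℝ × ℝ => ψ z.2) (cylMeasure T) :=
      (h1.continuous.comp continuous_snd).aestronglyMeasurable
    have i2 : Integrable (fun z : ℝ × ℝ => y z * (deriv φ z.1 * ψ z.2)) (cylMeasure T) := by
      have := (hy.integrable_mul hb1).mul_bdd (c := C) hψm (ae_of_all _ fun z => hC z.2)
      simpa only [Pi.mul_apply, mul_assoc] using this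
    have i3 : Integrable (fun z : ℝ × ℝ => p z * (φ z.1 * ψ z.2)) (cylMeasure T) := by
      have := (hp.integrable_mul hb2).mul_bdd (c := C) hψm (ae_of_all _ fun z => hC z.2)
      simpa only [Pi.mul_apply, mul_assoc] using this
    have e1 : ∫ z, (y z * (deriv φ z.1 * ψ z.2) + p z * (φ z.1 * ψ z.2)) ∂(cylMeasure T) = 0 := by
      rw [integral_add i2 i3, htest]
      ring
    have i4 : Integrable (fun z : ℝ × ℝ => y z * (deriv φ z.1 * ψ z.2) + p z * (φ z.1 * ψ z.2))
        (cylMeasure T) := i2.add i3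
    rw [cylMeasure_eq_prod] at e1 i4
    rw [integral_prod_symm _ i4] at e1
    rw [← setIntegral_eq_integral_of_forall_compl_eq_zero (s := Ioo 0 T), ← timeMeasure, ← e1]
    · refine integral_congr_ae (ae_of_all _ fun t => ?_)
      simp only [smul_eq_mul]
      rw [← integral_const_mul]
      refine integral_congr_ae (ae_of_all _ fun x => ?_)
      ring
    · intro t ht
      rw [image_eq_zero_of_notMem_tsupport fun h' => ht (h3 h'), zero_smul]
  rw [← ae_restrict_iff' measurableSet_Ioo] at key
  filter_upwards [key, ae_memLp_slice hy, ae_memLp_slice hp] with t ht hyt hpt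
  have i5 : Integrable (fun x => y (x, t) * deriv φ x) intervalMeasure :=
    hyt.integrable_mul (hφ.memLp_deriv 2)
  have i6 : Integrable (fun x => p (x, t) * φ x) intervalMeasure :=
    hpt.integrable_mul (hφ.memLp 2)
  rw [integral_add i5 i6] at ht
  linarith

/-- The lateral condition supplies an `H¹₀` derivative at each time separately, with no
measurability in `t`. Testing with the countable family identifies it with the slice of `p`. -/
theorem ae_isH10Deriv_slice {T : ℝ} {y p : ℝ × ℝ → ℝ} (hy : MemLp y 2 (cylMeasure T))
    (hp : MemLp p 2 (cylMeasure T)) (h : IsWeakDx T y p)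
    (hlat : ∀ᵐ t ∂(timeMeasure T), MemH10 (fun x => y (x, t))) :
    ∀ᵐ t ∂(timeMeasure T), MemLp (fun x => p (x, t)) 2 intervalMeasure ∧
      IsH10Deriv (fun x => y (x, t)) (fun x => p (x, t)) := by
  obtain ⟨S, hSc, hSb, hS⟩ := exists_countable_separating_bumps
  have hall := (ae_ball_iff hSc).2 fun φ hφ => ae_forall_bump_of_isWeakDx hy hp h (hSb φ hφ)
  filter_upwards [hall, hlat, ae_memLp_slice hp] with t ht hlt hpt
  refine ⟨hpt, ?_⟩
  obtain ⟨g, hg, hgd⟩ := hlt.exists_isH10Deriv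
  have hz := hS (fun x => g x - p (x, t)) (hg.sub hpt) fun φ hφ => by
    have e1 := ht φ hφ
    have e2 := hgd φ ((hSb φ hφ).contDiff.of_le (by simp))
    have i1 : Integrable (fun x => g x * φ x) intervalMeasure :=
      hg.integrable_mul ((hSb φ hφ).memLp 2)
    have i2 : Integrable (fun x => p (x, t) * φ x) intervalMeasure :=
      hpt.integrable_mul ((hSb φ hφ).memLp 2)
    have e3 : ∀ x, φ x * (g x - p (x, t)) = g x * φ x - p (x, t) * φ x := fun x => by ring
    simp only [e3]
    rw [integral_sub i1 i2]
    linarith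
  intro ψ hψ
  rw [hgd ψ hψ]
  congr 1
  refine integral_congr_ae ?_
  filter_upwards [hz] with x hx
  have : g x = p (x, t) := by linarith
  simp only [this]

/-! ### Weak form with absolutely continuous test functions -/

theorem cylMeasure_mono {s t : ℝ} (h : s ≤ t) : cylMeasure s ≤ cylMeasure t :=
  Measure.restrict_mono (prod_mono_right (Ioo_subset_Ioo_right h)) le_rfl

theorem integral_mul_fst {τ : ℝ} {q : ℝ × ℝ → ℝ} {k : ℝ → ℝ} (hq : MemLp q 2 (cylMeasure τ))
    (hk : MemLp k 2 intervalMeasure) :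
    ∫ z, q z * k z.1 ∂(cylMeasure τ)
      = ∫ x, (∫ r, q (x, r) ∂(timeMeasure τ)) * k x ∂intervalMeasure := by
  have hk' : MemLp (fun z : ℝ × ℝ => k z.1) 2 (cylMeasure τ) := by
    rw [cylMeasure_eq_prod]
    exact hk.comp_fst (timeMeasure τ)
  have hi : Integrable (fun z : ℝ × ℝ => q z * k z.1) (cylMeasure τ) := hq.integrable_mul hk'
  rw [cylMeasure_eq_prod] at hi ⊢
  rw [integral_prod _ hi]
  simp only [integral_mul_const]

theorem integrable_integral_time {τ : ℝ} {q : ℝ × ℝ → ℝ} (hq : MemLp q 2 (cylMeasure τ)) :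
    Integrable (fun x => ∫ r, q (x, r) ∂(timeMeasure τ)) intervalMeasure := by
  have hi := hq.integrable (by simp)
  rw [cylMeasure_eq_prod] at hi
  exact hi.integral_prod_left

/-- The weak form at time `τ`, tested with bumps in `x`, extends to absolutely continuous
test functions in `x` that vanish at the end points. -/
theorem weakForm_of_forall_bump {τ : ℝ} {Y Y₀ V w : ℝ → ℝ} {q f : ℝ × ℝ → ℝ}
    (hY : MemLp Y 2 intervalMeasure) (hY₀ : MemLp Y₀ 2 intervalMeasure)
    (hq : MemLp q 2 (cylMeasure τ)) (hf : MemLp f 2 (cylMeasure τ))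
    (h : ∀ φ, IsBump φ → ∫ x, Y x * φ x ∂intervalMeasure
        + ∫ z, q z * deriv φ z.1 ∂(cylMeasure τ)
      = ∫ x, Y₀ x * φ x ∂intervalMeasure + ∫ z, f z * φ z.1 ∂(cylMeasure τ))
    (hV : AbsolutelyContinuousOnInterval V 0 1) (h0 : V 0 = 0) (h1 : V 1 = 0)
    (hw : ∀ᵐ x ∂intervalMeasure, HasDerivAt V (w x) x) (hw2 : MemLp w 2 intervalMeasure) :
    ∫ x, Y x * V x ∂intervalMeasure + ∫ z, q z * w z.1 ∂(cylMeasure τ)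
      = ∫ x, Y₀ x * V x ∂intervalMeasure + ∫ z, f z * V z.1 ∂(cylMeasure τ) := by
  have hVc := continuousOn_Icc_of_absolutelyContinuous hV
  have hYi : Integrable Y intervalMeasure := hY.integrable (by simp)
  have hY₀i : Integrable Y₀ intervalMeasure := hY₀.integrable (by simp)
  have hQ := integrable_integral_time hq
  have hR := integrable_integral_time hf
  have split : ∀ k : ℝ → ℝ, ContinuousOn k (Icc 0 1) →
      ∫ x, (Y x - Y₀ x - ∫ r, f (x, r) ∂(timeMeasure τ)) * k x ∂intervalMeasure
        = ∫ x, Y x * k x ∂intervalMeasure - ∫ x, Y₀ x * k x ∂intervalMeasure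
          - ∫ z, f z * k z.1 ∂(cylMeasure τ) := fun k hk => by
    have i1 := integrable_mul_of_continuousOn hYi hk
    have i2 := integrable_mul_of_continuousOn hY₀i hk
    have i3 := integrable_mul_of_continuousOn hR hk
    have i4 : Integrable (fun x => Y x * k x - Y₀ x * k x) intervalMeasure := i1.sub i2
    rw [integral_mul_fst hf (memLp_of_continuousOn hk 2), ← integral_sub i1 i2,
      ← integral_sub i4 i3]
    simp only [sub_mul]
  -- As the test function does not depend on time, Fubini reduces the weak form to one dimension:
  -- the time integral of `q` has weak derivative `Y - Y₀` minus the time integral of `f`.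
  have main := integral_mul_deriv_of_forall_bump (V := V) (w := w) hQ ((hYi.sub hY₀i).sub hR)
    (fun φ hφ => by
      have e1 := h φ hφ
      have e2 := split φ hφ.contDiff.continuous.continuousOn
      rw [integral_mul_fst hq (hφ.memLp_deriv 2)] at e1
      simp only [Pi.sub_apply]
      rw [e2]
      linarith) hV h0 h1 hw
  simp only [Pi.sub_apply] at main
  rw [split V hVc, ← integral_mul_fst hq hw2] at main
  linarith

theorem IsBump.isTest {φ : ℝ → ℝ} (h : IsBump φ) (T : ℝ) : IsTest T (fun z => φ z.1) := by
  obtain ⟨δ, hδ, -, hz⟩ := h.exists_margin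
  exact ⟨h.contDiff.comp contDiff_fst, δ, hδ, fun x _ t _ hx => hz x hx⟩

theorem dx_fst (φ : ℝ → ℝ) (z : ℝ × ℝ) : dx (fun z => φ z.1) z = deriv φ z.1 := rfl

theorem dt_fst (φ : ℝ → ℝ) (z : ℝ × ℝ) : dt (fun z => φ z.1) z = 0 := by simp [dt]

theorem ae_eq_initial_of_forall_bump {Y Y₀ : ℝ → ℝ} (hY : MemLp Y 2 intervalMeasure)
    (hY₀ : MemLp Y₀ 2 intervalMeasure)
    (h : ∀ φ, IsBump φ → ∫ x, Y x * φ x ∂intervalMeasure = ∫ x, Y₀ x * φ x ∂intervalMeasure) :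
    ∀ᵐ x ∂intervalMeasure, Y x = Y₀ x := by
  have hz : ∀ᵐ x ∂intervalMeasure, Y x - Y₀ x = 0 := by
    refine ae_eq_zero_of_forall_integral_bump
      ((hY.integrable (by simp)).sub (hY₀.integrable (by simp))) fun ψ hψ => ?_
    have i1 : Integrable (fun x => Y x * ψ x) intervalMeasure := hY.integrable_mul (hψ.memLp 2)
    have i2 : Integrable (fun x => Y₀ x * ψ x) intervalMeasure := hY₀.integrable_mul (hψ.memLp 2)
    have e : ∀ x, ψ x * (Y x - Y₀ x) = Y x * ψ x - Y₀ x * ψ x := fun x => by ring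
    simp only [e]
    rw [integral_sub i1 i2, h ψ hψ, sub_self]
  filter_upwards [hz] with x hx using sub_eq_zero.1 hx

theorem cylMeasure_zero : cylMeasure 0 = 0 := by simp [cylMeasure, cyl]

/-! ### The smooth step and Lipschitz compositions -/

theorem smoothTransition_contDiff : ContDiff ℝ ∞ Real.smoothTransition :=
  Real.smoothTransition.contDiff

theorem hasDerivAt_smoothTransition (s : ℝ) :
    HasDerivAt Real.smoothTransition (deriv Real.smoothTransition s) s :=
  (smoothTransition_contDiff.differentiable (by simp) s).hasDerivAt

theorem continuous_deriv_smoothTransition : Continuous (deriv Real.smoothTransition) :=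
  smoothTransition_contDiff.continuous_deriv (by simp)

theorem deriv_smoothTransition_nonneg (s : ℝ) : 0 ≤ deriv Real.smoothTransition s :=
  Real.smoothTransition.monotone.deriv_nonneg

theorem exists_bound_deriv_smoothTransition :
    ∃ K : ℝ≥0, ∀ s, ‖deriv Real.smoothTransition s‖₊ ≤ K := by
  have hcs : HasCompactSupport (deriv Real.smoothTransition) := by
    refine HasCompactSupport.intro (isCompact_Icc (a := (0 : ℝ)) (b := 1)) fun s hs => ?_
    rw [mem_Icc, not_and_or, not_le, not_le] at hs
    rcases hs with hs | hs
    · have : Real.smoothTransition =ᶠ[𝓝 s] fun _ => 0 := by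
        filter_upwards [Iio_mem_nhds hs] with r hr using
          Real.smoothTransition.zero_of_nonpos (le_of_lt hr)
      rw [this.deriv_eq, deriv_const]
    · have : Real.smoothTransition =ᶠ[𝓝 s] fun _ => 1 := by
        filter_upwards [Ioi_mem_nhds hs] with r hr using
          Real.smoothTransition.one_of_one_le (le_of_lt hr)
      rw [this.deriv_eq, deriv_const]
  obtain ⟨C, hC⟩ := hcs.exists_bound_of_continuous continuous_deriv_smoothTransition
  refine ⟨C.toNNReal, fun s => ?_⟩
  rw [← NNReal.coe_le_coe, coe_nnnorm]
  exact (hC s).trans (Real.le_coe_toNNReal C)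

theorem _root_.LipschitzWith.comp_absolutelyContinuousOnInterval {X Y : Type*}
    [PseudoMetricSpace X] [PseudoMetricSpace Y] {g : X → Y} {K : ℝ≥0} (hg : LipschitzWith K g)
    {u : ℝ → X} {a b : ℝ} (hu : AbsolutelyContinuousOnInterval u a b) :
    AbsolutelyContinuousOnInterval (fun x => g (u x)) a b := by
  unfold AbsolutelyContinuousOnInterval at hu ⊢
  have h := Tendsto.const_mul (K : ℝ) hu
  rw [mul_zero] at h
  refine squeeze_zero (fun E => Finset.sum_nonneg fun _ _ => dist_nonneg) (fun E => ?_) h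
  rw [Finset.mul_sum]
  exact Finset.sum_le_sum fun i _ => hg.dist_le_mul _ _

/-! ### Barrier, cutoff and entropy density -/

/-- The primitive `A` of `a` with `A 0 = 0`. -/
noncomputable def primitive (a : ℝ → ℝ) (s : ℝ) : ℝ := ∫ r in (0 : ℝ)..s, a r

/-- The stationary supersolution, written for `A(w)`: `A(w)'' = -F` and `w = m` at `0` and `1`. -/
noncomputable def barrier (a : ℝ → ℝ) (m F x : ℝ) : ℝ := primitive a m + F * (x * (1 - x)) / 2

noncomputable def barrierDeriv (F x : ℝ) : ℝ := F * (1 - 2 * x) / 2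

/-- A smooth cutoff of `A(s) - A(w(x))` that vanishes exactly where `s ≤ w(x)`. -/
noncomputable def cutoff (a : ℝ → ℝ) (m F x s : ℝ) : ℝ :=
  Real.smoothTransition (primitive a s - barrier a m F x)

/-- The convex function of `s` with derivative `cutoff` that vanishes for `s ≤ w(x)`. -/
noncomputable def energyDensity (a : ℝ → ℝ) (m F x s : ℝ) : ℝ := ∫ r in m..s, cutoff a m F x r

section

variable {a : ℝ → ℝ} {ρ κ m F : ℝ}

theorem hasDerivAt_primitive (ha : Continuous a) (s : ℝ) : HasDerivAt (primitive a) (a s) s :=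
  (ha.integral_hasStrictDerivAt 0 s).hasDerivAt

theorem continuous_primitive (ha : Continuous a) : Continuous (primitive a) :=
  continuous_iff_continuousAt.2 fun s => (hasDerivAt_primitive ha s).continuousAt

theorem mul_sub_le_primitive_sub (ha : Continuous a) (haρ : ∀ s, ρ ≤ a s) {s t : ℝ} (hst : s ≤ t) :
    ρ * (t - s) ≤ primitive a t - primitive a s := by
  rw [primitive, primitive, intervalIntegral.integral_interval_sub_left
    (ha.intervalIntegrable _ _) (ha.intervalIntegrable _ _)]
  have := intervalIntegral.integral_mono_on (μ := volume) hst (intervalIntegrable_const (c := ρ))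
    (ha.intervalIntegrable s t) fun x _ => haρ x
  simpa [mul_comm] using this

theorem monotone_primitive (ha : Continuous a) (hρ : 0 ≤ ρ) (haρ : ∀ s, ρ ≤ a s) :
    Monotone (primitive a) := fun s t hst => by
  have := mul_sub_le_primitive_sub ha haρ hst
  have := mul_nonneg hρ (sub_nonneg.2 hst)
  linarith

theorem lipschitzWith_primitive (ha : Continuous a) (hρ : 0 ≤ ρ) (haρ : ∀ s, ρ ≤ a s)
    (haκ : ∀ s, a s ≤ κ) : LipschitzWith κ.toNNReal (primitive a) := by
  refine lipschitzWith_of_nnnorm_deriv_le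
    (fun s => (hasDerivAt_primitive ha s).differentiableAt) fun s => ?_
  rw [(hasDerivAt_primitive ha s).deriv, ← NNReal.coe_le_coe, coe_nnnorm,
    Real.norm_of_nonneg (hρ.trans (haρ s))]
  exact (haκ s).trans (Real.le_coe_toNNReal κ)

theorem hasDerivAt_barrier (x : ℝ) : HasDerivAt (barrier a m F) (barrierDeriv F x) x := by
  have h := ((((hasDerivAt_id x).mul ((hasDerivAt_id x).const_sub 1)).const_mul F).div_const
    2).const_add (primitive a m)
  convert! h using 1
  simp only [barrierDeriv, id]
  ring

theorem continuous_barrier : Continuous (barrier a m F) :=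
  continuous_iff_continuousAt.2 fun x => (hasDerivAt_barrier x).continuousAt

theorem continuous_barrierDeriv : Continuous (barrierDeriv F) := by
  unfold barrierDeriv
  fun_prop

theorem hasDerivAt_barrierDeriv (x : ℝ) : HasDerivAt (barrierDeriv F) (-F) x := by
  have h := ((((hasDerivAt_id x).const_mul 2).const_sub 1).const_mul F).div_const 2
  convert! h using 1
  ring

theorem contDiff_barrier : ContDiff ℝ 1 (barrier a m F) := by
  unfold barrier
  fun_prop

theorem contDiff_barrierDeriv : ContDiff ℝ 1 (barrierDeriv F) := by
  unfold barrierDeriv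
  fun_prop

theorem le_barrier (hF : 0 ≤ F) {x : ℝ} (hx : x ∈ Icc (0 : ℝ) 1) :
    primitive a m ≤ barrier a m F x := by
  have := mul_nonneg hF (mul_nonneg hx.1 (sub_nonneg.2 hx.2))
  unfold barrier
  linarith

/-- `x(1-x) ≤ 1/4`, with equality at the midpoint. -/
theorem barrier_le (hF : 0 ≤ F) (x : ℝ) : barrier a m F x ≤ primitive a m + F / 8 := by
  unfold barrier
  nlinarith [mul_nonneg hF (sq_nonneg (2 * x - 1))]

theorem continuous_cutoff (ha : Continuous a) :
    Continuous (fun z : ℝ × ℝ => cutoff a m F z.1 z.2) :=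
  Real.smoothTransition.continuous.comp
    (((continuous_primitive ha).comp continuous_snd).sub (continuous_barrier.comp continuous_fst))

theorem continuous_cutoff_right (ha : Continuous a) (x : ℝ) : Continuous (cutoff a m F x) :=
  (continuous_cutoff ha).comp (Continuous.prodMk_right x)

theorem cutoff_nonneg (x s : ℝ) : 0 ≤ cutoff a m F x s := Real.smoothTransition.nonneg _

theorem cutoff_le_one (x s : ℝ) : cutoff a m F x s ≤ 1 := Real.smoothTransition.le_one _

theorem monotone_cutoff (ha : Continuous a) (hρ : 0 ≤ ρ) (haρ : ∀ s, ρ ≤ a s) (x : ℝ) :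
    Monotone (cutoff a m F x) := fun _ _ hst =>
  Real.smoothTransition.monotone (sub_le_sub_right (monotone_primitive ha hρ haρ hst) _)

theorem cutoff_eq_zero (ha : Continuous a) (hρ : 0 ≤ ρ) (haρ : ∀ s, ρ ≤ a s) (hF : 0 ≤ F)
    {x s : ℝ} (hx : x ∈ Icc (0 : ℝ) 1) (hs : s ≤ m) : cutoff a m F x s = 0 := by
  refine Real.smoothTransition.zero_of_nonpos ?_
  have h1 := monotone_primitive ha hρ haρ hs
  have h2 := le_barrier (a := a) (m := m) hF hx
  linarith

theorem energyDensity_sub (ha : Continuous a) (x s t : ℝ) :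
    energyDensity a m F x t - energyDensity a m F x s = ∫ r in s..t, cutoff a m F x r :=
  intervalIntegral.integral_interval_sub_left
    ((continuous_cutoff_right ha x).intervalIntegrable _ _)
    ((continuous_cutoff_right ha x).intervalIntegrable _ _)

/-- The density is convex because the cutoff is nondecreasing in `s`. The tangent is taken at the
later value `t`, so that the test function frozen at the later time controls the entropy increment.
-/
theorem energyDensity_sub_le (ha : Continuous a) (hρ : 0 ≤ ρ) (haρ : ∀ s, ρ ≤ a s) (x s t : ℝ) :
    energyDensity a m F x t - energyDensity a m F x s ≤ (t - s) * cutoff a m F x t := by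
  rw [energyDensity_sub ha]
  have hc := continuous_cutoff_right (m := m) (F := F) ha x
  have hm := monotone_cutoff (m := m) (F := F) ha hρ haρ x
  rcases le_total s t with hst | hst
  · have := intervalIntegral.integral_mono_on (μ := volume) hst (hc.intervalIntegrable s t)
      (intervalIntegrable_const (c := cutoff a m F x t)) fun r hr => hm hr.2
    simpa using this
  · have := intervalIntegral.integral_mono_on (μ := volume) hst
      (intervalIntegrable_const (c := cutoff a m F x t)) (hc.intervalIntegrable t s)
      fun r hr => hm hr.1
    rw [intervalIntegral.integral_symm]
    simp only [intervalIntegral.integral_const, smul_eq_mul] at this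
    linarith

theorem abs_energyDensity_sub_le (ha : Continuous a) (x s t : ℝ) :
    |energyDensity a m F x t - energyDensity a m F x s| ≤ |t - s| := by
  rw [energyDensity_sub ha]
  have := intervalIntegral.norm_integral_le_of_norm_le_const (a := s) (b := t) (C := 1)
    (f := cutoff a m F x) fun r _ => by
      rw [Real.norm_of_nonneg (cutoff_nonneg x r)]
      exact cutoff_le_one x r
  simpa using this

theorem energyDensity_eq_zero (ha : Continuous a) (hρ : 0 ≤ ρ) (haρ : ∀ s, ρ ≤ a s) (hF : 0 ≤ F)
    {x s : ℝ} (hx : x ∈ Icc (0 : ℝ) 1) (hs : s ≤ m) : energyDensity a m F x s = 0 := by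
  refine intervalIntegral.integral_zero_ae (ae_of_all _ fun r hr => ?_)
  rw [uIoc_of_ge hs] at hr
  exact cutoff_eq_zero ha hρ haρ hF hx hr.2

theorem energyDensity_nonneg (ha : Continuous a) (hρ : 0 ≤ ρ) (haρ : ∀ s, ρ ≤ a s) (hF : 0 ≤ F)
    {x : ℝ} (hx : x ∈ Icc (0 : ℝ) 1) (s : ℝ) : 0 ≤ energyDensity a m F x s := by
  rcases le_total s m with hs | hs
  · rw [energyDensity_eq_zero ha hρ haρ hF hx hs]
  · exact intervalIntegral.integral_nonneg hs fun r _ => cutoff_nonneg x r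

/-- For `s > m` the integral of the cutoff vanishes only if the cutoff is zero at `s`, that is,
`A(s) ≤ A(w)`. The lower bound `ρ` for `a` then turns the excess `F/8` of the barrier into `F/(8ρ)`.
-/
theorem le_of_energyDensity_eq_zero (ha : Continuous a) (hρ : 0 < ρ) (haρ : ∀ s, ρ ≤ a s)
    (hF : 0 ≤ F) {x s : ℝ} (h : energyDensity a m F x s = 0) :
    s ≤ m + F / (8 * ρ) := by
  rcases le_total s m with hs | hs
  · have : 0 ≤ F / (8 * ρ) := by positivity
    linarith
  rcases hs.eq_or_lt with rfl | hs
  · have : 0 ≤ F / (8 * ρ) := by positivity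
    linarith
  have hA : primitive a s ≤ barrier a m F x := by
    by_contra! hlt
    refine (intervalIntegral.integral_pos hs (continuous_cutoff_right ha x).continuousOn
      (fun r _ => cutoff_nonneg x r) ⟨s, right_mem_Icc.2 hs.le, ?_⟩).ne' h
    exact Real.smoothTransition.pos_of_pos (sub_pos.2 hlt)
  have h1 := mul_sub_le_primitive_sub ha haρ hs.le
  have h2 := barrier_le (a := a) (m := m) hF x
  have h3 : ρ * (s - m) ≤ F / 8 := by linarith
  have h4 : s - m ≤ F / 8 / ρ := by rwa [le_div_iff₀ hρ, mul_comm]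
  rw [div_div] at h4
  linarith

theorem continuous_energyDensity (ha : Continuous a) :
    Continuous (fun z : ℝ × ℝ => energyDensity a m F z.1 z.2) := by
  have h : Continuous (Function.uncurry fun (z : ℝ × ℝ) (r : ℝ) => cutoff a m F z.1 r) :=
    (continuous_cutoff ha).comp ((continuous_fst.comp continuous_fst).prodMk continuous_snd)
  exact intervalIntegral.continuous_parametric_intervalIntegral_of_continuous h continuous_snd

/-- The derivative of `x ↦ cutoff a m F x (u x)` at a point where `u = s` and `u' = g`. -/
noncomputable def cutoffDeriv (a : ℝ → ℝ) (m F x s g : ℝ) : ℝ :=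
  deriv Real.smoothTransition (primitive a s - barrier a m F x) * (a s * g - barrierDeriv F x)

theorem hasDerivAt_cutoff_comp (ha : Continuous a) {u : ℝ → ℝ} {g x : ℝ} (h : HasDerivAt u g x) :
    HasDerivAt (fun x => cutoff a m F x (u x)) (cutoffDeriv a m F x (u x) g) x :=
  (hasDerivAt_smoothTransition _).comp x
    (((hasDerivAt_primitive ha (u x)).comp x h).sub (hasDerivAt_barrier x))

theorem absolutelyContinuousOnInterval_cutoff_comp (ha : Continuous a) (hρ : 0 ≤ ρ)
    (haρ : ∀ s, ρ ≤ a s) (haκ : ∀ s, a s ≤ κ) {u : ℝ → ℝ}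
    (hu : AbsolutelyContinuousOnInterval u 0 1) :
    AbsolutelyContinuousOnInterval (fun x => cutoff a m F x (u x)) 0 1 := by
  obtain ⟨K, hK⟩ := exists_bound_deriv_smoothTransition
  have h1 := (lipschitzWith_primitive ha hρ haρ haκ).comp_absolutelyContinuousOnInterval hu
  have h2 : AbsolutelyContinuousOnInterval (barrier a m F) 0 1 :=
    contDiff_barrier.contDiffOn.absolutelyContinuousOnInterval
  exact (lipschitzWith_of_nnnorm_deriv_le (fun s => (hasDerivAt_smoothTransition s).differentiableAt)
    hK).comp_absolutelyContinuousOnInterval (h1.fun_sub h2)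

theorem abs_cutoffDeriv_le {K : ℝ≥0} (hK : ∀ s, ‖deriv Real.smoothTransition s‖₊ ≤ K) (x s g : ℝ) :
    |cutoffDeriv a m F x s g| ≤ K * (|a s * g| + |barrierDeriv F x|) := by
  rw [cutoffDeriv, abs_mul]
  exact mul_le_mul (hK _) (abs_sub _ _) (abs_nonneg _) K.2

/-- By parts, `F ∫ V` equals the pairing of `A(w)'` with `V'`; the boundary terms vanish since `u =
0 ≤ m` at the ends. The difference of the two sides is the integral of `θ' * (A(u)' - A(w)')²`,
hence nonnegative. -/
theorem integral_cutoff_le (ha : Continuous a) (hρ : 0 ≤ ρ)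
    (haρ : ∀ s, ρ ≤ a s) (haκ : ∀ s, a s ≤ κ) (hF : 0 ≤ F) (hm : 0 ≤ m) {u g : ℝ → ℝ}
    (hu : AbsolutelyContinuousOnInterval u 0 1) (hu0 : u 0 = 0) (hu1 : u 1 = 0)
    (hg : ∀ᵐ x ∂intervalMeasure, HasDerivAt u (g x) x)
    (hi : MemLp (fun x => a (u x) * g x) 2 intervalMeasure)
    (hw : MemLp (fun x => cutoffDeriv a m F x (u x) (g x)) 2 intervalMeasure) :
    F * ∫ x, cutoff a m F x (u x) ∂intervalMeasure
      ≤ ∫ x, a (u x) * g x * cutoffDeriv a m F x (u x) (g x) ∂intervalMeasure := by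
  have hV := absolutelyContinuousOnInterval_cutoff_comp (m := m) (F := F) ha hρ haρ haκ hu
  have hB : AbsolutelyContinuousOnInterval (barrierDeriv F) 0 1 :=
    contDiff_barrierDeriv.contDiffOn.absolutelyContinuousOnInterval
  have h1 := integral_mul_deriv_of_absolutelyContinuous hB hV
    (ae_of_all _ hasDerivAt_barrierDeriv)
    (by filter_upwards [hg] with x hx using hasDerivAt_cutoff_comp ha hx)
  have hb2 : MemLp (barrierDeriv F) 2 intervalMeasure :=
    memLp_of_continuousOn continuous_barrierDeriv.continuousOn 2
  rw [hu0, hu1, cutoff_eq_zero ha hρ haρ hF (by simp) hm,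
    cutoff_eq_zero ha hρ haρ hF (by simp) hm, integral_const_mul] at h1
  have i1 : Integrable (fun x => a (u x) * g x * cutoffDeriv a m F x (u x) (g x))
    intervalMeasure := hi.integrable_mul hw
  have i2 : Integrable (fun x => barrierDeriv F x * cutoffDeriv a m F x (u x) (g x))
    intervalMeasure := hb2.integrable_mul hw
  have h2 : 0 ≤ ∫ x, (a (u x) * g x * cutoffDeriv a m F x (u x) (g x)
      - barrierDeriv F x * cutoffDeriv a m F x (u x) (g x)) ∂intervalMeasure := by
    refine integral_nonneg fun x => ?_
    have e : a (u x) * g x * cutoffDeriv a m F x (u x) (g x)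
        - barrierDeriv F x * cutoffDeriv a m F x (u x) (g x)
        = deriv Real.smoothTransition (primitive a (u x) - barrier a m F x)
          * (a (u x) * g x - barrierDeriv F x) ^ 2 := by
      rw [cutoffDeriv]
      ring
    simp only [e]
    exact mul_nonneg (deriv_smoothTransition_nonneg _) (sq_nonneg _)
  rw [integral_sub i1 i2, h1] at h2
  linarith

end

/-! ### Time increments -/

/-- Continuity of time translations in `L²` of the plane. -/
theorem tendsto_eLpNorm_sub_translate {q : ℝ × ℝ → ℝ} (hq : MemLp q 2 volume) :
    Tendsto (fun δ : ℝ => eLpNorm (fun z : ℝ × ℝ => q (z.1, z.2 - δ) - q z) 2 volume)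
      (𝓝 0) (𝓝 0) := by
  let g : C(ℝ, C(ℝ × ℝ, ℝ × ℝ)) :=
    (ContinuousMap.mk (fun w : ℝ × (ℝ × ℝ) => (w.2.1, w.2.2 - w.1)) (by fun_prop)).curry
  have hgm : ∀ δ, MeasurePreserving (g δ) volume volume := fun δ =>
    (MeasurePreserving.id volume).prod (measurePreserving_sub_right volume δ)
  have h := Filter.Tendsto.compMeasurePreservingLp (tendsto_const_nhds (x := hq.toLp q) (f := 𝓝 (0 : ℝ)))
    (g.continuous.tendsto 0) hgm (hgm 0) (by simp)
  rw [tendsto_iff_edist_tendsto_0] at h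
  refine h.congr fun δ => ?_
  rw [Lp.edist_def]
  refine eLpNorm_congr_ae ?_
  have h1 : ∀ δ, Lp.compMeasurePreserving (g δ) (hgm δ) (hq.toLp q)
      =ᵐ[volume] fun z => q (z.1, z.2 - δ) := fun δ =>
    (Lp.coeFn_compMeasurePreserving _ (hgm δ)).trans
      ((hgm δ).quasiMeasurePreserving.ae_eq hq.coeFn_toLp)
  filter_upwards [h1 δ, h1 0] with z hz hz0
  rw [Pi.sub_apply, hz, hz0, sub_zero]

theorem lintegral_mul_enorm_le {α : Type*} [MeasurableSpace α] {ν : Measure α} {g k : α → ℝ}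
    (hg : AEStronglyMeasurable g ν) (hk : AEStronglyMeasurable k ν) :
    ∫⁻ x, ‖g x‖ₑ * ‖k x‖ₑ ∂ν ≤ eLpNorm g 2 ν * eLpNorm k 2 ν := by
  calc ∫⁻ x, ‖g x‖ₑ * ‖k x‖ₑ ∂ν = eLpNorm (g • k) 1 ν := by
        rw [eLpNorm_one_eq_lintegral_enorm]
        simp [enorm_mul]
    _ ≤ eLpNorm g 2 ν * eLpNorm k 2 ν := eLpNorm_smul_le_mul_eLpNorm hk hg

theorem integral_le_of_lintegral_ofReal_le {α : Type*} [MeasurableSpace α] {ν : Measure α}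
    {g : α → ℝ} (hg : Integrable g ν) {c : ℝ} (hc : 0 ≤ c)
    (h : ∫⁻ x, ENNReal.ofReal (g x) ∂ν ≤ ENNReal.ofReal c) : ∫ x, g x ∂ν ≤ c := by
  rw [integral_eq_lintegral_pos_part_sub_lintegral_neg_part hg]
  have := ENNReal.toReal_le_of_le_ofReal hc h
  have := ENNReal.toReal_nonneg (a := ∫⁻ x, ENNReal.ofReal (-g x) ∂ν)
  linarith

/-- A continuous function with `∫ (E(t) - E(t-h))⁺ dt = o(h)` and `E(0) = 0` is nonpositive. -/
theorem nonpos_of_lintegral_increment_le {E : ℝ → ℝ} {τ : ℝ} (hτ : 0 < τ)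
    (hE : ContinuousOn E (Icc 0 τ)) (hE0 : E 0 = 0)
    (h : ∀ ε > (0 : ℝ), ∃ h₀ > (0 : ℝ), ∀ h, 0 < h → h < h₀ → h < τ →
      ∫⁻ t in Ioo h τ, ENNReal.ofReal (E t - E (t - h)) ≤ ENNReal.ofReal (ε * h)) :
    E τ ≤ 0 := by
  by_contra! hpos
  set e := E τ with he
  have c1 := hE τ (right_mem_Icc.2 hτ.le)
  have c0 := hE 0 (left_mem_Icc.2 hτ.le)
  -- For a small step `k`, the function exceeds `e/2` on the last interval of length `k` and is
  -- below `e/8` on the first. The integral of `E(t) - E(t-k)` telescopes to the difference of these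
  -- two pieces, at least `3ek/8`, whereas the hypothesis allows only `ek/8`.
  obtain ⟨d1, hd1, H1⟩ := Metric.continuousWithinAt_iff.1 c1 (e / 2) (by positivity)
  obtain ⟨d0, hd0, H0⟩ := Metric.continuousWithinAt_iff.1 c0 (e / 8) (by positivity)
  obtain ⟨h₀, hh₀, H⟩ := h (e / 8) (by positivity)
  obtain ⟨k, hk0, hk⟩ := exists_between (show 0 < min (min d1 d0) (min h₀ τ) by
    simp only [lt_min_iff]; exact ⟨⟨hd1, hd0⟩, hh₀, hτ⟩)
  simp only [lt_min_iff] at hk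
  obtain ⟨⟨hk1, hk2⟩, hk3, hk4⟩ := hk
  have ii : ∀ s t, s ∈ Icc 0 τ → t ∈ Icc 0 τ → IntervalIntegrable E volume s t :=
    fun s t hs ht => (hE.mono (uIcc_subset_Icc hs ht)).intervalIntegrable
  have m0 : (0 : ℝ) ∈ Icc 0 τ := ⟨le_rfl, hτ.le⟩
  have mτ : τ ∈ Icc 0 τ := ⟨hτ.le, le_rfl⟩
  have mk : k ∈ Icc 0 τ := ⟨hk0.le, hk4.le⟩
  have mk' : τ - k ∈ Icc 0 τ := ⟨by linarith, by linarith⟩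
  have i1 := ii k τ mk mτ
  have i2 : IntervalIntegrable (fun t => E (t - k)) volume k τ := by
    have := (ii 0 (τ - k) m0 mk').comp_sub_right k
    simpa using this
  have e1 : ∫ t in k..τ, (E t - E (t - k)) ≤ e / 8 * k := by
    rw [intervalIntegral.integral_of_le hk4.le, integral_Ioc_eq_integral_Ioo]
    have hi : IntegrableOn (fun t => E t - E (t - k)) (Ioo k τ) :=
      (intervalIntegrable_iff_integrableOn_Ioo_of_le hk4.le).1 (i1.sub i2)
    exact integral_le_of_lintegral_ofReal_le hi (by positivity) (H k hk0 hk3 hk4)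
  rw [intervalIntegral.integral_sub i1 i2, intervalIntegral.integral_comp_sub_right, sub_self] at e1
  have e2 := intervalIntegral.integral_add_adjacent_intervals (ii 0 k m0 mk) i1
  have e3 := intervalIntegral.integral_add_adjacent_intervals (ii 0 _ m0 mk') (ii _ τ mk' mτ)
  have e4 : ∫ _ in (τ - k)..τ, e / 2 ≤ ∫ t in (τ - k)..τ, E t := by
    refine intervalIntegral.integral_mono_on (by linarith) intervalIntegrable_const
      (ii _ τ mk' mτ) fun t ht => ?_
    have h1 := H1 (x := t) ⟨by linarith [ht.1], ht.2⟩ (by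
      rw [Real.dist_eq, abs_lt]; constructor <;> linarith [ht.1, ht.2])
    rw [Real.dist_eq, abs_lt] at h1
    linarith [h1.1]
  have e5 : ∫ t in (0 : ℝ)..k, E t ≤ ∫ _ in (0 : ℝ)..k, e / 8 := by
    refine intervalIntegral.integral_mono_on hk0.le (ii 0 k m0 mk) intervalIntegrable_const
      fun t ht => ?_
    have h1 := H0 (x := t) ⟨ht.1, by linarith [ht.2]⟩ (by
      rw [Real.dist_eq, abs_lt]; constructor <;> linarith [ht.1, ht.2])
    rw [Real.dist_eq, abs_lt, hE0] at h1
    linarith [h1.2]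
  simp only [intervalIntegral.integral_const, smul_eq_mul] at e4 e5
  have : 0 < k * e := by positivity
  nlinarith

/-- The averaged increments of `q` over time steps below `h`, tested with `W`, are `o(h)`. -/
theorem exists_lintegral_increment_le {q W : ℝ × ℝ → ℝ} (hqm : Measurable q) (hWm : Measurable W)
    (hq : MemLp q 2 volume) (hW : MemLp W 2 volume) {ε : ℝ} (hε : 0 < ε) :
    ∃ h₀ > (0 : ℝ), ∀ h, 0 < h → h < h₀ →
      ∫⁻ t, ∫⁻ δ in Ioo 0 h, ∫⁻ x, ‖q (x, t - δ) - q (x, t)‖ₑ * ‖W (x, t)‖ₑ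
        ≤ ENNReal.ofReal (ε * h) := by
  have hlim : Tendsto (fun δ : ℝ => eLpNorm (fun z : ℝ × ℝ => q (z.1, z.2 - δ) - q z) 2 volume
      * eLpNorm W 2 volume) (𝓝 0) (𝓝 0) := by
    simpa using ENNReal.Tendsto.mul_const (tendsto_eLpNorm_sub_translate hq)
      (Or.inr hW.eLpNorm_ne_top)
  have hev := hlim.eventually_le_const (u := ENNReal.ofReal ε) (by simpa using hε)
  obtain ⟨h₀, hh₀, H⟩ := Metric.eventually_nhds_iff.1 hev
  refine ⟨h₀, hh₀, fun h hh hh' => ?_⟩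
  have hm : Measurable fun w : (ℝ × ℝ) × ℝ =>
      ‖q (w.2, w.1.1 - w.1.2) - q (w.2, w.1.1)‖ₑ * ‖W (w.2, w.1.1)‖ₑ := by fun_prop
  -- With the shift `δ` outermost, Cauchy-Schwarz in the plane applies for each fixed `δ`, and the
  -- outer interval of length `h` supplies the factor `h`.
  rw [lintegral_lintegral_swap hm.lintegral_prod_right'.aemeasurable]
  calc ∫⁻ δ in Ioo 0 h, ∫⁻ t, ∫⁻ x, ‖q (x, t - δ) - q (x, t)‖ₑ * ‖W (x, t)‖ₑ
      ≤ ∫⁻ _ in Ioo 0 h, ENNReal.ofReal ε := by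
        refine setLIntegral_mono' measurableSet_Ioo fun δ hδ => ?_
        have hm2 : Measurable fun z : ℝ × ℝ => q (z.1, z.2 - δ) - q z := by fun_prop
        have hm3 : Measurable fun z : ℝ × ℝ => ‖q (z.1, z.2 - δ) - q z‖ₑ * ‖W z‖ₑ := by fun_prop
        refine le_trans (le_of_eq ?_) ((lintegral_mul_enorm_le hm2.aestronglyMeasurable
          hWm.aestronglyMeasurable).trans (H ?_))
        · exact (lintegral_prod_symm _ hm3.aemeasurable).symm
        · rw [Real.dist_eq, sub_zero, abs_of_pos hδ.1]
          exact hδ.2.trans hh'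
    _ = ENNReal.ofReal (ε * h) := by
        rw [setLIntegral_const, Real.volume_Ioo, sub_zero, ENNReal.ofReal_mul hε.le]

/-! ### Entropy growth of a weak solution -/

section

variable {a : ℝ → ℝ} {ρ κ m F T : ℝ}

theorem aestronglyMeasurable_comp_pair {α : Type*} [MeasurableSpace α] {ν : Measure α}
    {Φ : ℝ → ℝ → ℝ} (hΦ : Continuous fun z : ℝ × ℝ => Φ z.1 z.2) {X S : α → ℝ}
    (hX : AEStronglyMeasurable X ν) (hS : AEStronglyMeasurable S ν) :
    AEStronglyMeasurable (fun x => Φ (X x) (S x)) ν :=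
  hΦ.comp_aestronglyMeasurable (hX.prodMk hS)

theorem abs_energyDensity_le (ha : Continuous a) (x s : ℝ) :
    |energyDensity a m F x s| ≤ |s - m| := by
  have h := abs_energyDensity_sub_le (m := m) (F := F) ha x m s
  have h0 : energyDensity a m F x m = 0 := by
    rw [energyDensity, intervalIntegral.integral_same]
  rwa [h0, sub_zero] at h

theorem integrable_energyDensity (ha : Continuous a) {u : ℝ → ℝ}
    (hu : Integrable u intervalMeasure) :
    Integrable (fun x => energyDensity a m F x (u x)) intervalMeasure := by
  have hm : AEStronglyMeasurable (fun x => energyDensity a m F x (u x)) intervalMeasure :=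
    aestronglyMeasurable_comp_pair (Φ := energyDensity a m F) (continuous_energyDensity ha)
      aestronglyMeasurable_id hu.aestronglyMeasurable
  have hb : Integrable (fun x => u x - m) intervalMeasure := hu.sub (integrable_const m)
  exact hb.mono hm (ae_of_all _ fun x => abs_energyDensity_le ha x (u x))

/-- The entropy of the part of `y(·,t)` above the supersolution. -/
noncomputable def energy (a : ℝ → ℝ) (m F : ℝ) (y : ℝ × ℝ → ℝ) (t : ℝ) : ℝ :=
  ∫ x, energyDensity a m F x (y (x, t)) ∂intervalMeasure

/-- The density is 1-Lipschitz in its last variable, and on a probability space the `L¹` norm is at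
most the `L²` norm. -/
theorem continuousOn_energy (ha : Continuous a) {y : ℝ × ℝ → ℝ}
    (hmem : ∀ t ∈ Icc (0 : ℝ) T, MemLp (fun x => y (x, t)) 2 intervalMeasure)
    (hcont : ∀ t ∈ Icc (0 : ℝ) T,
      Tendsto (fun s => eLpNorm (fun x => y (x, s) - y (x, t)) 2 intervalMeasure)
        (𝓝[Icc (0 : ℝ) T] t) (𝓝 0)) :
    ContinuousOn (energy a m F y) (Icc 0 T) := by
  intro t ht
  rw [ContinuousWithinAt, tendsto_iff_edist_tendsto_0]
  refine tendsto_of_tendsto_of_tendsto_of_le_of_le' tendsto_const_nhds (hcont t ht)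
    (Eventually.of_forall fun _ => zero_le) ?_
  filter_upwards [self_mem_nhdsWithin] with s hs
  have is := integrable_energyDensity (m := m) (F := F) ha ((hmem s hs).integrable (by simp))
  have it := integrable_energyDensity (m := m) (F := F) ha ((hmem t ht).integrable (by simp))
  rw [edist_eq_enorm_sub, energy, energy, ← integral_sub is it]
  refine (enorm_integral_le_lintegral_enorm _).trans ?_
  refine le_trans ?_ (eLpNorm_le_eLpNorm_of_exponent_le (p := 1) (q := 2) (by norm_num)
    ((hmem s hs).sub (hmem t ht)).aestronglyMeasurable)
  rw [eLpNorm_one_eq_lintegral_enorm]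
  refine lintegral_mono fun x => ?_
  rw [enorm_le_iff_norm_le]
  exact abs_energyDensity_sub_le ha x _ _

theorem integral_cylMeasure_sub {G : ℝ × ℝ → ℝ} (hG : Integrable G (cylMeasure T)) {s t : ℝ}
    (hs : s ∈ Icc (0 : ℝ) T) (ht : t ∈ Icc (0 : ℝ) T) :
    ∫ z, G z ∂(cylMeasure t) - ∫ z, G z ∂(cylMeasure s)
      = ∫ r in s..t, ∫ x, G (x, r) ∂intervalMeasure := by
  have e : ∀ τ ∈ Icc (0 : ℝ) T, ∫ z, G z ∂(cylMeasure τ)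
      = ∫ r in (0 : ℝ)..τ, ∫ x, G (x, r) ∂intervalMeasure := fun τ hτ => by
    have hi : Integrable G (intervalMeasure.prod (timeMeasure τ)) := by
      rw [← cylMeasure_eq_prod]
      exact hG.mono_measure (cylMeasure_mono hτ.2)
    rw [cylMeasure_eq_prod, integral_prod_symm _ hi, timeMeasure,
      intervalIntegral.integral_of_le hτ.1, integral_Ioc_eq_integral_Ioo]
  have hi : IntervalIntegrable (fun r => ∫ x, G (x, r) ∂intervalMeasure) volume 0 T := by
    rw [cylMeasure_eq_prod] at hG
    exact (intervalIntegrable_iff_integrableOn_Ioo_of_le (hs.1.trans hs.2)).2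
      hG.integral_prod_right
  have hi' : ∀ τ ∈ Icc (0 : ℝ) T,
      IntervalIntegrable (fun r => ∫ x, G (x, r) ∂intervalMeasure) volume 0 τ := fun τ hτ =>
    hi.mono_set (by
      rw [uIcc_of_le hτ.1, uIcc_of_le (hτ.1.trans hτ.2)]
      exact Icc_subset_Icc_right hτ.2)
  rw [e t ht, e s hs, intervalIntegral.integral_interval_sub_left (hi' t ht) (hi' s hs)]

theorem memLp_cutoffDeriv {α : Type*} [MeasurableSpace α] {ν : Measure α} [IsFiniteMeasure ν]
    (ha : Continuous a) {X S G : α → ℝ} (hX : AEStronglyMeasurable X ν)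
    (hS : AEStronglyMeasurable S ν)
    (hX' : ∀ᵐ z ∂ν, X z ∈ Ioo (0 : ℝ) 1) (h : MemLp (fun z => a (S z) * G z) 2 ν) :
    MemLp (fun z => cutoffDeriv a m F (X z) (S z) (G z)) 2 ν := by
  obtain ⟨K, hK⟩ := exists_bound_deriv_smoothTransition
  have hb : MemLp (fun z => K * (|a (S z) * G z| + |F|)) 2 ν :=
    (h.abs.add (memLp_const |F|)).const_mul (K : ℝ)
  refine hb.mono ?_ ?_
  · have h1 : AEStronglyMeasurable
        (fun z => deriv Real.smoothTransition (primitive a (S z) - barrier a m F (X z))) ν :=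
      continuous_deriv_smoothTransition.comp_aestronglyMeasurable
        (((continuous_primitive ha).comp_aestronglyMeasurable hS).sub
          (continuous_barrier.comp_aestronglyMeasurable hX))
    exact h1.mul (h.aestronglyMeasurable.sub
      (continuous_barrierDeriv.comp_aestronglyMeasurable hX))
  · filter_upwards [hX'] with z hz
    have hbd : |barrierDeriv F (X z)| ≤ |F| := by
      rw [barrierDeriv, abs_div, abs_mul, abs_two]
      have : |1 - 2 * X z| ≤ 1 := by
        rw [abs_le]
        constructor <;> linarith [hz.1, hz.2]
      nlinarith [abs_nonneg F]
    refine (abs_cutoffDeriv_le hK _ _ _).trans (le_trans ?_ (le_abs_self _))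
    gcongr

theorem ofReal_integral_le_lintegral_ofReal {α : Type*} [MeasurableSpace α] {ν : Measure α}
    (g : α → ℝ) : ENNReal.ofReal (∫ x, g x ∂ν) ≤ ∫⁻ x, ENNReal.ofReal (g x) ∂ν := by
  by_cases hg : Integrable g ν
  · rw [integral_eq_lintegral_pos_part_sub_lintegral_neg_part hg]
    refine (ENNReal.ofReal_le_ofReal (sub_le_self _ ENNReal.toReal_nonneg)).trans
      ENNReal.ofReal_toReal_le
  · simp [integral_undef hg]

/-- Entropy growth on `(s,t)` is controlled by the time oscillation of the flux `q`. -/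
theorem ofReal_energy_sub_le (ha : Continuous a) (hρ : 0 < ρ) (haρ : ∀ s, ρ ≤ a s)
    (haκ : ∀ s, a s ≤ κ) (hF : 0 ≤ F) (hm : 0 ≤ m) {y q f : ℝ × ℝ → ℝ} {y₀ g : ℝ → ℝ}
    (hmem : ∀ t ∈ Icc (0 : ℝ) T, MemLp (fun x => y (x, t)) 2 intervalMeasure)
    (hy₀ : MemLp y₀ 2 intervalMeasure) (hq : MemLp q 2 (cylMeasure T))
    (hf : MemLp f 2 (cylMeasure T)) (hfF : ∀ᵐ z ∂(cylMeasure T), f z ≤ F)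
    (hweak : ∀ τ ∈ Icc (0 : ℝ) T, ∀ φ, IsBump φ → ∫ x, y (x, τ) * φ x ∂intervalMeasure
        + ∫ z, q z * deriv φ z.1 ∂(cylMeasure τ)
      = ∫ x, y₀ x * φ x ∂intervalMeasure + ∫ z, f z * φ z.1 ∂(cylMeasure τ))
    {s t : ℝ} (hs : s ∈ Icc (0 : ℝ) T) (ht : t ∈ Icc (0 : ℝ) T) (hst : s ≤ t)
    (hg : MemLp g 2 intervalMeasure) (hyg : IsH10Deriv (fun x => y (x, t)) g)
    (hqt : ∀ᵐ x ∂intervalMeasure, q (x, t) = a (y (x, t)) * g x) :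
    ENNReal.ofReal (energy a m F y t - energy a m F y s)
      ≤ ∫⁻ r in Ioo s t, ∫⁻ x, ‖q (x, r) - q (x, t)‖ₑ
          * ‖cutoffDeriv a m F x (y (x, t)) (g x)‖ₑ ∂intervalMeasure := by
  have hgi : Integrable g intervalMeasure := hg.integrable (by simp)
  have hyi : ∀ t ∈ Icc (0 : ℝ) T, Integrable (fun x => y (x, t)) intervalMeasure :=
    fun t ht => (hmem t ht).integrable (by simp)
  -- The absolutely continuous representative of `y(·,t)`, with genuine zero boundary values.
  set u : ℝ → ℝ := fun x => ∫ r in (0 : ℝ)..x, g r with hu_def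
  have hyu := hyg.ae_eq (hyi t ht) hgi
  have hu : AbsolutelyContinuousOnInterval u 0 1 := absolutelyContinuousOnInterval_primitive hgi
  have hu0 : u 0 = 0 := intervalIntegral.integral_same
  have hu1 : u 1 = 0 := by
    rw [← hyg.integral_eq_zero, integral_intervalMeasure]
  have hu' : ∀ᵐ x ∂intervalMeasure, HasDerivAt u (g x) x := ae_hasDerivAt_primitive hgi
  have huc := continuousOn_Icc_of_absolutelyContinuous hu
  set V : ℝ → ℝ := fun x => cutoff a m F x (u x) with hV_def
  set w : ℝ → ℝ := fun x => cutoffDeriv a m F x (u x) (g x) with hw_def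
  have hV : AbsolutelyContinuousOnInterval V 0 1 :=
    absolutelyContinuousOnInterval_cutoff_comp ha hρ.le haρ haκ hu
  have hVc := continuousOn_Icc_of_absolutelyContinuous hV
  have hV0 : V 0 = 0 := by
    show cutoff a m F 0 (u 0) = 0
    rw [hu0]
    exact cutoff_eq_zero ha hρ.le haρ hF (by simp) hm
  have hV1 : V 1 = 0 := by
    show cutoff a m F 1 (u 1) = 0
    rw [hu1]
    exact cutoff_eq_zero ha hρ.le haρ hF (by simp) hm
  have hVw : ∀ᵐ x ∂intervalMeasure, HasDerivAt V (w x) x := by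
    filter_upwards [hu'] with x hx using hasDerivAt_cutoff_comp ha hx
  have hag : MemLp (fun x => a (u x) * g x) 2 intervalMeasure := by
    refine (hg.const_mul κ).mono
      ((ha.comp_aestronglyMeasurable (integrable_of_continuousOn huc).aestronglyMeasurable).mul
        hg.aestronglyMeasurable) (ae_of_all _ fun x => ?_)
    rw [norm_mul, norm_mul]
    refine mul_le_mul_of_nonneg_right ?_ (norm_nonneg _)
    rw [Real.norm_of_nonneg (hρ.le.trans (haρ _))]
    exact (haκ _).trans (le_abs_self _)
  have hw2 : MemLp w 2 intervalMeasure := memLp_cutoffDeriv ha aestronglyMeasurable_id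
    (integrable_of_continuousOn huc).aestronglyMeasurable
    ae_intervalMeasure_mem hag
  have hV2 : MemLp V 2 intervalMeasure := memLp_of_continuousOn hVc 2
  have hcut := integral_cutoff_le (m := m) (F := F) ha hρ.le haρ haκ hF hm hu hu0 hu1 hu' hag hw2
  have hqu : ∀ᵐ x ∂intervalMeasure, q (x, t) = a (u x) * g x := by
    filter_upwards [hqt, hyu] with x h1 h2
    rw [h1, h2]
  have hqt2 : MemLp (fun x => q (x, t)) 2 intervalMeasure :=
    (memLp_congr_ae hqu).2 hag
  -- `V` is built from the slice at time `t` but is admissible in the weak form at every `τ`; it is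
  -- used at `τ = s` and at `τ = t`.
  have wf : ∀ τ ∈ Icc (0 : ℝ) T, ∫ x, y (x, τ) * V x ∂intervalMeasure
      = ∫ x, y₀ x * V x ∂intervalMeasure
        + ∫ z, (f z * V z.1 - q z * w z.1) ∂(cylMeasure τ) := fun τ hτ => by
    have hfτ := hf.mono_measure (cylMeasure_mono hτ.2)
    have hqτ := hq.mono_measure (cylMeasure_mono hτ.2)
    have h := weakForm_of_forall_bump (hmem τ hτ) hy₀ hqτ hfτ (hweak τ hτ) hV hV0 hV1 hVw hw2
    have i1 : Integrable (fun z : ℝ × ℝ => f z * V z.1) (cylMeasure τ) :=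
      hfτ.integrable_mul (by rw [cylMeasure_eq_prod]; exact hV2.comp_fst _)
    have i2 : Integrable (fun z : ℝ × ℝ => q z * w z.1) (cylMeasure τ) :=
      hqτ.integrable_mul (by rw [cylMeasure_eq_prod]; exact hw2.comp_fst _)
    rw [integral_sub i1 i2]
    linarith
  have hGi : Integrable (fun z : ℝ × ℝ => f z * V z.1 - q z * w z.1) (cylMeasure T) := by
    have hV3 : MemLp (fun z : ℝ × ℝ => V z.1) 2 (cylMeasure T) := by
      rw [cylMeasure_eq_prod]
      exact hV2.comp_fst _
    have hw3 : MemLp (fun z : ℝ × ℝ => w z.1) 2 (cylMeasure T) := by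
      rw [cylMeasure_eq_prod]
      exact hw2.comp_fst _
    exact (hf.integrable_mul hV3).sub (hq.integrable_mul hw3)
  have hE : energy a m F y t - energy a m F y s
      ≤ ∫ r in s..t, ∫ x, (f (x, r) * V x - q (x, r) * w x) ∂intervalMeasure := by
    rw [← integral_cylMeasure_sub hGi hs ht]
    have j1 := integrable_mul_of_continuousOn (hyi t ht) hVc
    have j2 := integrable_mul_of_continuousOn (hyi s hs) hVc
    have j3 := integrable_energyDensity (m := m) (F := F) ha (hyi t ht)
    have j4 := integrable_energyDensity (m := m) (F := F) ha (hyi s hs)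
    have e1 : energy a m F y t - energy a m F y s
        ≤ ∫ x, y (x, t) * V x ∂intervalMeasure - ∫ x, y (x, s) * V x ∂intervalMeasure := by
      rw [energy, energy, ← integral_sub j3 j4, ← integral_sub j1 j2]
      refine integral_mono_ae (j3.sub j4) (j1.sub j2) ?_
      filter_upwards [hyu] with x hx
      have := energyDensity_sub_le (m := m) (F := F) ha hρ.le haρ x (y (x, s)) (y (x, t))
      have hVx : V x = cutoff a m F x (y (x, t)) := by rw [hV_def, hx]
      rw [hVx, ← sub_mul]
      exact this
    rw [wf t ht, wf s hs] at e1
    linarith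
  refine (ENNReal.ofReal_le_ofReal hE).trans ?_
  rw [intervalIntegral.integral_of_le hst, integral_Ioc_eq_integral_Ioo]
  refine (ofReal_integral_le_lintegral_ofReal _).trans ?_
  have hslices : ∀ᵐ r ∂(timeMeasure T), MemLp (fun x => f (x, r)) 2 intervalMeasure ∧
      MemLp (fun x => q (x, r)) 2 intervalMeasure ∧
      ∀ᵐ x ∂intervalMeasure, f (x, r) ≤ F := by
    have h3 := ae_ae_of_ae_cylMeasure hfF
    filter_upwards [ae_memLp_slice hf, ae_memLp_slice hq, h3] with r h1 h2 h3
      using ⟨h1, h2, h3⟩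
  have hslices' : ∀ᵐ r ∂(volume.restrict (Ioo s t)),
      MemLp (fun x => f (x, r)) 2 intervalMeasure ∧
      MemLp (fun x => q (x, r)) 2 intervalMeasure ∧
      ∀ᵐ x ∂intervalMeasure, f (x, r) ≤ F :=
    ae_mono (Measure.restrict_mono (Ioo_subset_Ioo hs.1 ht.2) le_rfl) hslices
  refine lintegral_mono_ae ?_
  filter_upwards [hslices'] with r hr
  obtain ⟨hfr, hqr, hfFr⟩ := hr
  have k1 : Integrable (fun x => f (x, r) * V x) intervalMeasure := hfr.integrable_mul hV2
  have k2 : Integrable (fun x => q (x, r) * w x) intervalMeasure := hqr.integrable_mul hw2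
  have k3 : Integrable (fun x => q (x, t) * w x) intervalMeasure := hqt2.integrable_mul hw2
  have b1 : ∫ x, f (x, r) * V x ∂intervalMeasure ≤ F * ∫ x, V x ∂intervalMeasure := by
    rw [← integral_const_mul]
    refine integral_mono_ae k1 ((integrable_of_continuousOn hVc).const_mul F) ?_
    filter_upwards [hfFr] with x hx
    exact mul_le_mul_of_nonneg_right hx (cutoff_nonneg _ _)
  have b2 : ∫ x, q (x, t) * w x ∂intervalMeasure
      = ∫ x, a (u x) * g x * w x ∂intervalMeasure := by
    refine integral_congr_ae ?_
    filter_upwards [hqu] with x hx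
    simp only [hx]
  -- Replacing `q(r)` by `q(t)` makes the supersolution estimate `hcut` available; it absorbs the
  -- source term, and only the oscillation of the flux remains.
  have b3 : ∫ x, (f (x, r) * V x - q (x, r) * w x) ∂intervalMeasure
      ≤ ∫ x, (q (x, t) - q (x, r)) * w x ∂intervalMeasure := by
    simp only [sub_mul]
    rw [integral_sub k1 k2, integral_sub k3 k2, b2]
    linarith
  refine (ENNReal.ofReal_le_ofReal b3).trans ((Real.ofReal_le_enorm _).trans
    ((enorm_integral_le_lintegral_enorm _).trans (le_of_eq (lintegral_congr_ae ?_))))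
  filter_upwards [hyu] with x hx
  rw [enorm_mul, enorm_sub_rev, hw_def, hx]

end

/-! ### The comparison principle -/

theorem measurableSet_cyl (T : ℝ) : MeasurableSet (cyl T) := measurableSet_Ioo.prod measurableSet_Ioo

theorem ae_cylMeasure_of_ae_ae {T : ℝ} {P : ℝ × ℝ → Prop} (hP : MeasurableSet {z | P z})
    (h : ∀ᵐ t ∂(timeMeasure T), ∀ᵐ x ∂intervalMeasure, P (x, t)) :
    ∀ᵐ z ∂(cylMeasure T), P z := by
  rw [cylMeasure_eq_prod]
  exact (Measure.ae_prod_iff_ae_ae hP).2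
    ((Measure.ae_ae_comm (p := fun x t => P (x, t)) hP).2 h)

theorem setLIntegral_comp_sub_left (G : ℝ → ℝ≥0∞) (t h : ℝ) :
    ∫⁻ δ in Ioo 0 h, G (t - δ) = ∫⁻ r in Ioo (t - h) t, G r := by
  have := (Measure.measurePreserving_sub_left volume t).setLIntegral_comp_preimage_emb
    (MeasurableEquiv.subLeft t).measurableEmbedding G (Ioo (t - h) t)
  simpa using this

/-- **Comparison principle**: a weak solution lies below the stationary supersolution. -/
theorem ae_le_of_isH10Deriv {a : ℝ → ℝ} {ρ κ m F T : ℝ} (ha : Continuous a) (hρ : 0 < ρ)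
    (haρ : ∀ s, ρ ≤ a s) (haκ : ∀ s, a s ≤ κ) (hF : 0 ≤ F) (hm : 0 ≤ m)
    {y p f : ℝ × ℝ → ℝ} {y₀ : ℝ → ℝ} (hy₀ : MemLp y₀ 2 intervalMeasure)
    (hy₀m : ∀ᵐ x ∂intervalMeasure, y₀ x ≤ m)
    (hf : MemLp f 2 (cylMeasure T)) (hfF : ∀ᵐ z ∂(cylMeasure T), f z ≤ F)
    (hy : MemLp y 2 (cylMeasure T)) (hp : MemLp p 2 (cylMeasure T))
    (hmem : ∀ t ∈ Icc (0 : ℝ) T, MemLp (fun x => y (x, t)) 2 intervalMeasure)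
    (hcont : ∀ t ∈ Icc (0 : ℝ) T,
      Tendsto (fun s => eLpNorm (fun x => y (x, s) - y (x, t)) 2 intervalMeasure)
        (𝓝[Icc (0 : ℝ) T] t) (𝓝 0))
    (hyp : ∀ᵐ t ∂(timeMeasure T), MemLp (fun x => p (x, t)) 2 intervalMeasure ∧
      IsH10Deriv (fun x => y (x, t)) (fun x => p (x, t)))
    (hweak : ∀ τ ∈ Icc (0 : ℝ) T, ∀ φ, IsBump φ → ∫ x, y (x, τ) * φ x ∂intervalMeasure
        + ∫ z, a (y z) * p z * deriv φ z.1 ∂(cylMeasure τ)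
      = ∫ x, y₀ x * φ x ∂intervalMeasure + ∫ z, f z * φ z.1 ∂(cylMeasure τ)) :
    ∀ᵐ z ∂(cylMeasure T), y z ≤ m + F / (8 * ρ) := by
  obtain ⟨y', hy'm, hyy'⟩ := hy.aestronglyMeasurable
  obtain ⟨p', hp'm, hpp'⟩ := hp.aestronglyMeasurable
  have hqm₀ : Measurable fun z => a (y' z) * p' z :=
    (ha.measurable.comp hy'm.measurable).mul hp'm.measurable
  -- The flux and the derivative of the cutoff are built from measurable representatives and
  -- extended by zero to the plane, where time translations act.
  set q : ℝ × ℝ → ℝ := (cyl T).indicator fun z => a (y' z) * p' z with hq_def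
  set W : ℝ × ℝ → ℝ := (cyl T).indicator fun z => cutoffDeriv a m F z.1 (y' z) (p' z) with hW_def
  have hqm : Measurable q := hqm₀.indicator (measurableSet_cyl T)
  have hWm : Measurable W := by
    refine Measurable.indicator ?_ (measurableSet_cyl T)
    have h1 : Measurable fun z : ℝ × ℝ =>
        deriv Real.smoothTransition (primitive a (y' z) - barrier a m F z.1) :=
      continuous_deriv_smoothTransition.measurable.comp
        (((continuous_primitive ha).measurable.comp hy'm.measurable).sub
          (continuous_barrier.measurable.comp measurable_fst))
    exact h1.mul (hqm₀.sub (continuous_barrierDeriv.measurable.comp measurable_fst))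
  have hmemcyl : ∀ᵐ z ∂(cylMeasure T), z ∈ cyl T := ae_restrict_mem (measurableSet_cyl T)
  have hqae : ∀ᵐ z ∂(cylMeasure T), q z = a (y z) * p z := by
    filter_upwards [hyy', hpp', hmemcyl] with z h1 h2 h3
    rw [hq_def, indicator_of_mem h3, h1, h2]
  have hWae : ∀ᵐ z ∂(cylMeasure T), W z = cutoffDeriv a m F z.1 (y z) (p z) := by
    filter_upwards [hyy', hpp', hmemcyl] with z h1 h2 h3
    rw [hW_def, indicator_of_mem h3, h1, h2]
  have hq₀ : MemLp (fun z => a (y' z) * p' z) 2 (cylMeasure T) := by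
    refine (hp.const_mul κ).mono hqm₀.aestronglyMeasurable ?_
    filter_upwards [hpp'] with z hz
    rw [norm_mul, norm_mul, hz]
    refine mul_le_mul_of_nonneg_right ?_ (norm_nonneg _)
    rw [Real.norm_of_nonneg (hρ.le.trans (haρ _))]
    exact (haκ _).trans (le_abs_self _)
  have hqv : MemLp q 2 volume := (memLp_indicator_iff_restrict (measurableSet_cyl T)).2 hq₀
  have hq : MemLp q 2 (cylMeasure T) := hqv.mono_measure Measure.restrict_le_self
  have hWv : MemLp W 2 volume := by
    refine (memLp_indicator_iff_restrict (measurableSet_cyl T)).2 ?_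
    change MemLp _ 2 (cylMeasure T)
    exact memLp_cutoffDeriv ha measurable_fst.aestronglyMeasurable hy'm.aestronglyMeasurable
      (by filter_upwards [hmemcyl] with z hz using hz.1) hq₀
  have hweak' : ∀ τ ∈ Icc (0 : ℝ) T, ∀ φ, IsBump φ → ∫ x, y (x, τ) * φ x ∂intervalMeasure
        + ∫ z, q z * deriv φ z.1 ∂(cylMeasure τ)
      = ∫ x, y₀ x * φ x ∂intervalMeasure + ∫ z, f z * φ z.1 ∂(cylMeasure τ) :=
    fun τ hτ φ hφ => by
      rw [← hweak τ hτ φ hφ]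
      congr 1
      refine integral_congr_ae ?_
      filter_upwards [ae_mono (cylMeasure_mono hτ.2) hqae] with z hz
      simp only [hz]
  have hgood : ∀ᵐ t ∂(timeMeasure T), ∀ s ∈ Icc (0 : ℝ) T, s ≤ t →
      ENNReal.ofReal (energy a m F y t - energy a m F y s)
        ≤ ∫⁻ r in Ioo s t, ∫⁻ x, ‖q (x, r) - q (x, t)‖ₑ * ‖W (x, t)‖ₑ := by
    have htm : ∀ᵐ t ∂(timeMeasure T), t ∈ Ioo 0 T := ae_restrict_mem measurableSet_Ioo
    filter_upwards [hyp, ae_ae_of_ae_cylMeasure hqae, ae_ae_of_ae_cylMeasure hWae, htm]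
      with t h1 h2 h3 h4 s hs hst
    refine (ofReal_energy_sub_le ha hρ haρ haκ hF hm hmem hy₀ hq hf hfF hweak' hs
      (Ioo_subset_Icc_self h4) hst h1.1 h1.2 h2).trans (lintegral_mono fun r => ?_)
    refine (lintegral_congr_ae ?_).trans_le (lintegral_mono' Measure.restrict_le_self le_rfl)
    filter_upwards [h3] with x hx
    rw [hx]
  have hEcont := continuousOn_energy (m := m) (F := F) ha hmem hcont
  have hEzero : ∀ τ ∈ Ioo 0 T, energy a m F y τ ≤ 0 := fun τ hτ => by
    have m0 : (0 : ℝ) ∈ Icc 0 T := ⟨le_rfl, (hτ.1.trans hτ.2).le⟩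
    refine nonpos_of_lintegral_increment_le hτ.1
      (hEcont.mono (Icc_subset_Icc_right hτ.2.le)) ?_ fun ε hε => ?_
    -- At `τ = 0` the space-time terms of the weak form disappear and leave the initial condition.
    · have hinit := ae_eq_initial_of_forall_bump (hmem 0 m0) hy₀ fun φ hφ => by
        simpa [cylMeasure_zero] using hweak 0 m0 φ hφ
      refine integral_eq_zero_of_ae ?_
      filter_upwards [hinit, hy₀m, ae_intervalMeasure_mem] with x h1 h2 h3
      exact energyDensity_eq_zero ha hρ.le haρ hF (Ioo_subset_Icc_self h3) (h1.trans_le h2)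
    · obtain ⟨h₀, hh₀, H⟩ := exists_lintegral_increment_le hqm hWm hqv hWv hε
      refine ⟨h₀, hh₀, fun h hh hh' _ => le_trans ?_ (H h hh hh')⟩
      refine le_trans ?_ (lintegral_mono' (Measure.restrict_le_self (s := Ioo h τ)) le_rfl)
      have hgood' := (ae_restrict_iff' measurableSet_Ioo).1 hgood
      refine setLIntegral_mono_ae' measurableSet_Ioo ?_
      filter_upwards [hgood'] with t ht htm
      -- The substitution `r = t - δ` turns the average over shifts into the integral over `(t-h,
      -- t)`.
      rw [setLIntegral_comp_sub_left (fun r => ∫⁻ x, ‖q (x, r) - q (x, t)‖ₑ * ‖W (x, t)‖ₑ)]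
      exact ht ⟨hh.trans htm.1, htm.2.trans hτ.2⟩ (t - h)
        ⟨by linarith [htm.1], by linarith [htm.2, hτ.2]⟩ (by linarith)
  have hslice : ∀ᵐ t ∂(timeMeasure T), ∀ᵐ x ∂intervalMeasure, y' (x, t) ≤ m + F / (8 * ρ) := by
    have htm : ∀ᵐ t ∂(timeMeasure T), t ∈ Ioo 0 T := ae_restrict_mem measurableSet_Ioo
    filter_upwards [htm, ae_ae_of_ae_cylMeasure hyy'] with t ht hyt
    have hnn : ∀ᵐ x ∂intervalMeasure, 0 ≤ energyDensity a m F x (y (x, t)) := by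
      filter_upwards [ae_intervalMeasure_mem] with x hx using
        energyDensity_nonneg ha hρ.le haρ hF (Ioo_subset_Icc_self hx) _
    have h0 : energy a m F y t = 0 := le_antisymm (hEzero t ht) (integral_nonneg_of_ae hnn)
    have hz := (integral_eq_zero_iff_of_nonneg_ae hnn (integrable_energyDensity ha
      ((hmem t (Ioo_subset_Icc_self ht)).integrable (by simp)))).1 h0
    filter_upwards [hz, hyt] with x h1 h2
    rw [← h2]
    exact le_of_energyDensity_eq_zero ha hρ haρ hF h1
  have hfin : ∀ᵐ z ∂(cylMeasure T), y' z ≤ m + F / (8 * ρ) :=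
    ae_cylMeasure_of_ae_ae (measurableSet_le hy'm.measurable measurable_const) hslice
  filter_upwards [hfin, hyy'] with z h1 h2
  rwa [h2]

/-! ### Two-sided almost everywhere bounds -/

theorem IsH10Deriv.neg {u g : ℝ → ℝ} (h : IsH10Deriv u g) :
    IsH10Deriv (fun x => -u x) (fun x => -g x) := fun ψ hψ => by
  have := h ψ hψ
  simp only [neg_mul, integral_neg]
  linarith

/-- Functions in `H¹₀(0,1)` vanish at `0`, so that their essential upper bounds are nonnegative. -/
theorem IsH10Deriv.nonneg_of_ae_le {u g : ℝ → ℝ} (h : IsH10Deriv u g)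
    (hu : MemLp u 2 intervalMeasure) (hg : MemLp g 2 intervalMeasure) {m : ℝ}
    (hm : ∀ᵐ x ∂intervalMeasure, u x ≤ m) : 0 ≤ m := by
  by_contra! hneg
  have hgi : Integrable g intervalMeasure := hg.integrable (by simp)
  have hc := continuousOn_Icc_of_absolutelyContinuous (absolutelyContinuousOnInterval_primitive hgi)
  -- If `m < 0`, the continuous representative, which is zero at `0`, stays above `m` on a short
  -- interval of positive measure.
  obtain ⟨d, hd, H⟩ := Metric.continuousWithinAt_iff.1 (hc 0 (by simp)) (-m) (by linarith)
  have hd1 : 0 < min d 1 := lt_min hd one_pos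
  have hnb : (ae (volume.restrict (Ioo 0 (min d 1)))).NeBot := by
    rw [ae_neBot, Ne, Measure.restrict_eq_zero, Real.volume_Ioo]
    simpa using hd1
  have hae : ∀ᵐ x ∂intervalMeasure, (∫ t in (0 : ℝ)..x, g t) ≤ m := by
    filter_upwards [h.ae_eq (hu.integrable (by simp)) hgi, hm] with x h1 h2
    rwa [← h1]
  have hae' : ∀ᵐ x ∂(volume.restrict (Ioo 0 (min d 1))), (∫ t in (0 : ℝ)..x, g t) ≤ m :=
    ae_mono (Measure.restrict_mono (Ioo_subset_Ioo_right (min_le_right _ _)) le_rfl) hae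
  obtain ⟨x, hx, hxm⟩ := (hae'.and (ae_restrict_mem measurableSet_Ioo)).exists
  have := H (x := x) ⟨hxm.1.le, (hxm.2.trans_le (min_le_right _ _)).le⟩ (by
    rw [Real.dist_eq, sub_zero, abs_of_pos hxm.1]
    exact hxm.2.trans_le (min_le_left _ _))
  rw [Real.dist_eq, intervalIntegral.integral_same, sub_zero, abs_lt] at this
  linarith [this.1]

/-- Real-valued essential suprema and infima are meaningful only for essentially bounded functions;
this secures it for `y₀`, which has a continuous representative. -/
theorem IsH10Deriv.exists_ae_abs_le {u g : ℝ → ℝ} (h : IsH10Deriv u g)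
    (hu : MemLp u 2 intervalMeasure) (hg : MemLp g 2 intervalMeasure) :
    ∃ C : ℝ, ∀ᵐ x ∂intervalMeasure, |u x| ≤ C := by
  have hgi : Integrable g intervalMeasure := hg.integrable (by simp)
  obtain ⟨C, hC⟩ := isCompact_Icc.exists_bound_of_continuousOn
    (continuousOn_Icc_of_absolutelyContinuous (absolutelyContinuousOnInterval_primitive hgi))
  refine ⟨C, ?_⟩
  filter_upwards [h.ae_eq (hu.integrable (by simp)) hgi, ae_intervalMeasure_mem] with x h1 h2
  rw [h1]
  exact hC x (Ioo_subset_Icc_self h2)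

theorem ae_abs_le_toReal_eLpNorm_top {α : Type*} [MeasurableSpace α] {ν : Measure α} {f : α → ℝ}
    (hf : MemLp f ⊤ ν) : ∀ᵐ z ∂ν, |f z| ≤ (eLpNorm f ⊤ ν).toReal := by
  filter_upwards [enorm_ae_le_eLpNormEssSup f ν] with z hz
  rw [← eLpNorm_exponent_top] at hz
  have := ENNReal.toReal_mono hf.eLpNorm_ne_top hz
  simpa using this

section essential

variable {α : Type*} [MeasurableSpace α] {ν : Measure α} {g : α → ℝ} {C : ℝ}

theorem isBoundedUnder_le_of_ae_abs_le (h : ∀ᵐ z ∂ν, |g z| ≤ C) :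
    IsBoundedUnder (· ≤ ·) (ae ν) g :=
  ⟨C, eventually_map.2 (h.mono fun _ hz => (le_abs_self _).trans hz)⟩

theorem isBoundedUnder_ge_of_ae_abs_le (h : ∀ᵐ z ∂ν, |g z| ≤ C) :
    IsBoundedUnder (· ≥ ·) (ae ν) g :=
  ⟨-C, eventually_map.2 (h.mono fun _ hz => (abs_le.1 hz).1)⟩

end essential

theorem ae_cylMeasure_neBot {T : ℝ} (hT : 0 < T) : (ae (cylMeasure T)).NeBot := by
  rw [ae_neBot, cylMeasure, Ne, Measure.restrict_eq_zero, cyl, Measure.volume_eq_prod,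
    Measure.prod_prod]
  simpa using hT

theorem ae_le_and_ae_ge_of_isWeakSolution
    {a : ℝ → ℝ} {ρ κ : ℝ} (ha : Continuous a) (hρ : 0 < ρ) (haρ : ∀ s, ρ ≤ a s)
    (haκ : ∀ s, a s ≤ κ) {T : ℝ} {y₀ : ℝ → ℝ} (hy₀ : MemH10 y₀) {f y : ℝ × ℝ → ℝ}
    (hf : MemLp f ⊤ (cylMeasure T)) (hyV : MemV10 T y) (hy : IsWeakSolution T a f y₀ y) (m : ℝ) :
    ((∀ᵐ x ∂intervalMeasure, y₀ x ≤ m) →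
      ∀ᵐ z ∂(cylMeasure T), y z ≤ m + 6 / ρ * (eLpNorm f ⊤ (cylMeasure T)).toReal) ∧
    ((∀ᵐ x ∂intervalMeasure, -y₀ x ≤ m) →
      ∀ᵐ z ∂(cylMeasure T), -y z ≤ m + 6 / ρ * (eLpNorm f ⊤ (cylMeasure T)).toReal) := by
  obtain ⟨g, hg, hyg⟩ := hy₀.exists_isH10Deriv
  obtain ⟨p, hp, hwd, hw⟩ := hy
  have hy2 : MemLp y 2 (cylMeasure T) := hyV.memV2.1.1
  have hf2 : MemLp f 2 (cylMeasure T) := hf.mono_exponent le_top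
  have hfb := ae_abs_le_toReal_eLpNorm_top hf
  set F := (eLpNorm f ⊤ (cylMeasure T)).toReal
  have hF : 0 ≤ F := ENNReal.toReal_nonneg
  -- The comparison yields the constant `1/8`, which is weakened here to `6`.
  have hconst : F / (8 * ρ) ≤ 6 / ρ * F := by
    rw [div_mul_eq_mul_div, div_le_div_iff₀ (by positivity) hρ]
    nlinarith [mul_nonneg hF hρ.le]
  have hslice := ae_isH10Deriv_slice hy2 hp hwd hyV.lateral
  have hweak : ∀ τ ∈ Icc (0 : ℝ) T, ∀ φ, IsBump φ → ∫ x, y (x, τ) * φ x ∂intervalMeasure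
        + ∫ z, a (y z) * p z * deriv φ z.1 ∂(cylMeasure τ)
      = ∫ x, y₀ x * φ x ∂intervalMeasure + ∫ z, f z * φ z.1 ∂(cylMeasure τ) := fun τ hτ φ hφ => by
    simpa [dt_fst, dx_fst] using hw _ (hφ.isTest T) τ hτ
  constructor
  · intro hm
    have h := ae_le_of_isH10Deriv ha hρ haρ haκ hF (hyg.nonneg_of_ae_le hy₀.1 hg hm) hy₀.1 hm hf2
      (hfb.mono fun z hz => (le_abs_self _).trans hz) hy2 hp hyV.memLp_slice hyV.continuous_slice
      hslice hweak
    filter_upwards [h] with z hz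
    linarith
  · intro hm
    -- `-y` solves the problem with coefficient `a(-s)`, source `-f` and datum `-y₀`; the bounds `ρ`
    -- and `κ` are unchanged.
    have h := ae_le_of_isH10Deriv (a := fun s => a (-s)) (y := fun z => -y z) (p := fun z => -p z)
      (f := fun z => -f z) (T := T) (ha.comp continuous_neg) hρ (fun s => haρ _) (fun s => haκ _) hF
      (hyg.neg.nonneg_of_ae_le hy₀.1.neg hg.neg hm) hy₀.1.neg hm hf2.neg
      (hfb.mono fun z hz => (neg_le_abs _).trans hz) hy2.neg hp.neg
      (fun t ht => (hyV.memLp_slice t ht).neg)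
      (fun t ht => by
        refine (hyV.continuous_slice t ht).congr fun s => ?_
        rw [← eLpNorm_neg]
        refine eLpNorm_congr_ae (ae_of_all _ fun x => ?_)
        simp only [Pi.neg_apply]
        ring)
      (hslice.mono fun t ht => ⟨ht.1.neg, ht.2.neg⟩)
      (fun τ hτ φ hφ => by
        have := hweak τ hτ φ hφ
        simp only [neg_neg, neg_mul, mul_neg, integral_neg, Pi.neg_apply]
        linarith)
    filter_upwards [h] with z hz
    linarith

end QuasilinearParabolic

/-! ### Passage to essential suprema and infima -/

theorem proposition2p4
    (a : ℝ → ℝ) (M ρ κ : ℝ)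
    (ha : ContDiff ℝ 2 a)
    (ha' : ∀ s, |deriv a s| ≤ M) (ha'' : ∀ s, |deriv (deriv a) s| ≤ M)
    (hρ : 0 < ρ) (haρ : ∀ s, ρ ≤ a s) (haκ : ∀ s, a s ≤ κ)
    (T : ℝ) (hT : 0 < T)
    (y₀ : ℝ → ℝ) (hy₀ : QuasilinearParabolic.MemH10 y₀)
    (f : ℝ × ℝ → ℝ) (hf : MeasureTheory.MemLp f ⊤ (QuasilinearParabolic.cylMeasure T))
    (y : ℝ × ℝ → ℝ)
    (hy_bdd : MeasureTheory.MemLp y ⊤ (QuasilinearParabolic.cylMeasure T))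
    (hyV : QuasilinearParabolic.MemV10 T y)
    (hy : QuasilinearParabolic.IsWeakSolution T a f y₀ y) :
    essSup y (QuasilinearParabolic.cylMeasure T)
        ≤ essSup y₀ QuasilinearParabolic.intervalMeasure
          + 6 / ρ * (MeasureTheory.eLpNorm f ⊤ (QuasilinearParabolic.cylMeasure T)).toReal ∧
    essInf y₀ QuasilinearParabolic.intervalMeasure
          - 6 / ρ * (MeasureTheory.eLpNorm f ⊤ (QuasilinearParabolic.cylMeasure T)).toReal
        ≤ essInf y (QuasilinearParabolic.cylMeasure T) ∧
    essSup (fun z => |y z|) (QuasilinearParabolic.cylMeasure T)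
        ≤ essSup (fun x => |y₀ x|) QuasilinearParabolic.intervalMeasure
          + 6 / ρ * (MeasureTheory.eLpNorm f ⊤ (QuasilinearParabolic.cylMeasure T)).toReal := by
  have hbounds := QuasilinearParabolic.ae_le_and_ae_ge_of_isWeakSolution ha.continuous hρ haρ haκ hy₀ hf hyV hy
  obtain ⟨g, hg, hyg⟩ := hy₀.exists_isH10Deriv
  obtain ⟨C₀, hC₀⟩ := hyg.exists_ae_abs_le hy₀.1 hg
  have hC := QuasilinearParabolic.ae_abs_le_toReal_eLpNorm_top hy_bdd
  have hnb := QuasilinearParabolic.ae_cylMeasure_neBot hT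
  have hC₀' : ∀ᵐ x ∂QuasilinearParabolic.intervalMeasure, |(|y₀ x|)| ≤ C₀ := by simpa using hC₀
  have hle : ∀ᵐ x ∂QuasilinearParabolic.intervalMeasure,
      |y₀ x| ≤ essSup (fun x => |y₀ x|) QuasilinearParabolic.intervalMeasure :=
    ae_le_essSup (QuasilinearParabolic.isBoundedUnder_le_of_ae_abs_le hC₀')
  refine ⟨?_, ?_, ?_⟩
  · exact essSup_le_of_ae_le _ ((hbounds _).1
      (ae_le_essSup (QuasilinearParabolic.isBoundedUnder_le_of_ae_abs_le hC₀)))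
      (QuasilinearParabolic.isBoundedUnder_ge_of_ae_abs_le hC).isCoboundedUnder_le
  · refine le_essInf_of_ae_le _ ?_
      (QuasilinearParabolic.isBoundedUnder_le_of_ae_abs_le hC).isCoboundedUnder_ge
    have h := (hbounds (-essInf y₀ QuasilinearParabolic.intervalMeasure)).2 (by
      filter_upwards [ae_essInf_le (QuasilinearParabolic.isBoundedUnder_ge_of_ae_abs_le hC₀)]
        with x hx
      linarith)
    filter_upwards [h] with z hz
    linarith
  -- The essential supremum of `|y₀|` bounds both `y₀` and `-y₀`, so both one-sided estimates hold
  -- with this `m`.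
  · refine essSup_le_of_ae_le _ ?_ (Filter.IsBoundedUnder.isCoboundedUnder_le
      ⟨0, Filter.eventually_map.2 (Filter.Eventually.of_forall fun z => abs_nonneg (y z))⟩)
    filter_upwards [(hbounds _).1 (hle.mono fun x hx => (le_abs_self _).trans hx),
      (hbounds _).2 (hle.mono fun x hx => (neg_le_abs _).trans hx)] with z h1 h2
    exact abs_le.2 ⟨by linarith, h1⟩
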